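/- Let $n\ge 1$, index the rows and columns of $n\times n$ matrices by $\mathbb Z/n\mathbb Z$, let $P$ be the permutation matrix whose entries $(i,i+1)$ equal $1$, and let $J$ be the all-ones matrix. The bipartite graph of a $(0,1)$-matrix $A$ has one vertex for each row and one for each column, row $i$ and column $j$ being adjacent iff $A_{ij}=1$; $A$ is called a biadjacency matrix of every graph isomorphic to it. A bipartite circulant on $2n$ vertices is a graph that has an $n\times n$ circulant $(0,1)$-matrix as a biadjacency matrix. The zero forcing number $Z(G)$ is the least size of a set $B$ of vertices such that, starting with exactly the vertices of $B$ black, all vertices become black by repeated application of the rule: a black vertex with exactly one white neighbour turns that neighbour black. For integers $a,g$ and positive integers $d\mid n$ and $c\mid d$ write $[a]_d=\{a+td : t\in\mathbb Z\}\subseteq\mathbb Z/n\mathbb Z$ and $[[g]_c]_d=\bigcup_{s\in\mathbb Z}[g+sc]_d$, and let $P^{[a]_d}$ and $P^{[[g]_c]_d}$ be the sums of $P^x$ over all $x\in[a]_d$ and all $x\in[[g]_c]_d$, respectively. Let $G$ be a connected $k$-regular bipartite circulant on $2n$ vertices with $Z(G)=2(k-1)$. Then there is a matrix $M$ of one of the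 following forms such that every $n\times n$ biadjacency matrix of $G$ arises from $M$ by independent permutations of rows and columns: 1. $M=I+P+P^2+\cdots+P^{k-1}$ with $2\le k\le n$; 2. $M=J-P^{\alpha}-P^{\alpha+i}-\cdots-P^{\alpha+ri}$ for some integers $\alpha$, $r\ge 0$ and $i$ such that $\gcd(i,n)>1$ and the order of $i$ in $\mathbb Z/n\mathbb Z$ is greater than $r+1$; 3. $M=P^{[[\gamma_1]_c]_d}+\cdots+P^{[[\gamma_{c-1}]_c]_d}+P^{\beta}+P^{[\beta+\alpha]_d}+\cdots+P^{[\beta+l\alpha]_d}$, where $d$ is a positive divisor of $n$, $c=\gcd(d,\alpha)$, $1\le l<d/c$, the integers $\beta,\gamma_1,\dots,\gamma_{c-1}$ are pairwise incongruent modulo $c$ (so that all powers of $P$ that occur are distinct), and one of the following holds: (a) $\alpha\in[[\gamma_j]_c]_d$ for some $1\le j\le c-1$; or (b) $\beta\in[-m\alpha]_d$ for some $m$ with $1\le m<l$ (so that $P^{[0]_d}$ and $P^{[\alpha]_d}$ are terms of the sum) and $d/c\le m+2(l-m)+1$. Conversely, every matrix of the form 1 (for any $2\le k\le n$), 2 or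 3 is a circulant $(0,1)$-matrix whose bipartite graph $G$ is connected and $k$-regular for some $k$, with $Z(G)=2(k-1)$. -/

import Mathlib

namespace BipCirc

/-! ### Zero forcing -/

/-- One application of the zero forcing rule: a black vertex `u` whose unique white neighbour
is `w` turns `w` black. -/
def ForceStep {V : Type*} (G : SimpleGraph V) (B B' : Set V) : Prop :=
  ∃ u ∈ B, ∃ w ∉ B, G.Adj u w ∧ (∀ x, G.Adj u x → x ∉ B → x = w) ∧ B' = insert w B

/-- `B` is a zero forcing set: repeated applications of the rule colour all vertices black. -/
def IsZeroForcingSet {V : Type*} (G : SimpleGraph V) (B : Set V) : Prop :=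
  Relation.ReflTransGen (ForceStep G) B Set.univ

/-- The zero forcing number `Z(G)` of a finite graph: the least size of a zero forcing set
(the whole vertex set is always one). -/
noncomputable def zeroForcingNumber {V : Type*} (G : SimpleGraph V) : ℕ :=
  sInf {m | ∃ B : Finset V, B.card = m ∧ IsZeroForcingSet G (B : Set V)}

/-! ### Bipartite graphs of matrices, bipartite circulants -/

/-- The bipartite graph with a vertex `inl i` for each row and `inr j` for each column of `A`,
where row `i` is joined to column `j` if and only if `A i j = 1`. -/
def bipGraph {m n : Type*} (A : Matrix m n ℤ) : SimpleGraph (m ⊕ n) where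
  Adj x y := match x, y with
    | Sum.inl i, Sum.inr j => A i j = 1
    | Sum.inr j, Sum.inl i => A i j = 1
    | _, _ => False
  symm := ⟨by
    rintro (i | i) (j | j) h
    · exact h
    · exact h
    · exact h
    · exact h⟩
  loopless := ⟨by
    rintro (i | i) h
    · exact h
    · exact h⟩

instance {m n : Type*} (A : Matrix m n ℤ) : DecidableRel (bipGraph A).Adj
  | Sum.inl i, Sum.inr j => inferInstanceAs (Decidable (A i j = 1))
  | Sum.inr j, Sum.inl i => inferInstanceAs (Decidable (A i j = 1))
  | Sum.inl _, Sum.inl _ => isFalse id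
  | Sum.inr _, Sum.inr _ => isFalse id

/-- `A` is a (0,1) matrix. -/
def IsZeroOne {m n : Type*} (A : Matrix m n ℤ) : Prop :=
  ∀ i j, A i j = 0 ∨ A i j = 1

/-- `A` is a circulant matrix (rows and columns are indexed by `ℤ/nℤ`). -/
def IsCirculant {n : ℕ} (A : Matrix (ZMod n) (ZMod n) ℤ) : Prop :=
  ∃ v : ZMod n → ℤ, A = Matrix.circulant v

/-- The (0,1) matrix `A` is a biadjacency matrix of the (unlabelled) graph `G`. -/
def IsBiadjacencyMatrix {V : Type*} (G : SimpleGraph V) {m n : Type*} (A : Matrix m n ℤ) : Prop :=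
  IsZeroOne A ∧ Nonempty (G ≃g bipGraph A)

/-- `G` is a bipartite circulant on `2n` vertices. -/
def IsBipartiteCirculant {V : Type*} (G : SimpleGraph V) (n : ℕ) : Prop :=
  ∃ A : Matrix (ZMod n) (ZMod n) ℤ, IsCirculant A ∧ IsBiadjacencyMatrix G A

/-- `A` arises from `M` by independent permutations of the rows and of the columns. -/
def PermEquiv {m n : Type*} (A M : Matrix m n ℤ) : Prop :=
  ∃ (σ : Equiv.Perm m) (τ : Equiv.Perm n), A = M.submatrix σ τ

/-! ### The three families -/

/-- The permutation matrix of the `n`-cycle: the entries `(i, i + 1)` are `1`. -/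
def P (n : ℕ) : Matrix (ZMod n) (ZMod n) ℤ :=
  Matrix.of fun i j => if j = i + 1 then 1 else 0

/-- The all-ones matrix. -/
def J (n : ℕ) : Matrix (ZMod n) (ZMod n) ℤ :=
  Matrix.of fun _ _ => 1

/-- `P^{[a]_d} = P^a + P^(a+d) + P^(a+2d) + ⋯ + P^(a-d)`; the number of summands is the order
of `d` in `ℤ/nℤ`. -/
noncomputable def PClass (n : ℕ) [NeZero n] (a d : ℕ) : Matrix (ZMod n) (ZMod n) ℤ :=
  ∑ t ∈ Finset.range (addOrderOf (d : ZMod n)), P n ^ (a + t * d)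

/-- `P^{[[g]_c]_d} = P^{[g]_d} + P^{[g+c]_d} + P^{[g+2c]_d} + ⋯ + P^{[g-c]_d}`; the number of
terms is the order of `c` in `ℤ/gcd(n,d)ℤ`. -/
noncomputable def PClassClass (n : ℕ) [NeZero n] (g c d : ℕ) : Matrix (ZMod n) (ZMod n) ℤ :=
  ∑ t ∈ Finset.range (addOrderOf (c : ZMod (Nat.gcd n d))), PClass n (g + t * c) d

/-- The class `[a]_d = {a, a + d, a + 2d, …}` in `ℤ/nℤ`. -/
def resClass {n : ℕ} (a d : ZMod n) : Set (ZMod n) :=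
  {x | ∃ t : ℕ, x = a + (t : ZMod n) * d}

/-- The double class `[[g]_c]_d`, the union of the classes `[g + sc]_d`, in `ℤ/nℤ`. -/
def resClassClass {n : ℕ} (g c d : ZMod n) : Set (ZMod n) :=
  {x | ∃ s : ℕ, x ∈ resClass (g + (s : ZMod n) * c) d}

/-- `I + P + ⋯ + P^(k-1)`, where `2 ≤ k ≤ n`. -/
def IsFamily1 (n : ℕ) [NeZero n] (k : ℕ) (M : Matrix (ZMod n) (ZMod n) ℤ) : Prop :=
  2 ≤ k ∧ k ≤ n ∧ M = ∑ t ∈ Finset.range k, P n ^ t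

/-- `J - P^a - P^(a+i) - ⋯ - P^(a+ri)`, where `gcd(i,n) > 1` and the order of `i` in `ℤ/nℤ` is
greater than `r + 1`. -/
def IsFamily2 (n : ℕ) [NeZero n] (M : Matrix (ZMod n) (ZMod n) ℤ) : Prop :=
  ∃ a r i : ℕ, 1 < Nat.gcd i n ∧ r + 1 < addOrderOf (i : ZMod n) ∧
    M = J n - ∑ t ∈ Finset.range (r + 1), P n ^ (a + t * i)

/-- `P^{[[γ₁]_c]_d} + ⋯ + P^{[[γ_{c-1}]_c]_d} + P^β + P^{[β+α]_d} + ⋯ + P^{[β+lα]_d}`, where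
`d ∣ n`, `c = gcd(d,α)`, `l ≥ 1`, all powers of `P` that occur are distinct (that is,
`β, γ₁, …, γ_{c-1}` are pairwise incongruent modulo `c`, and `l < d/c`), and either `α` lies in
one of the complete double classes, or `β ∈ [-mα]_d` with `1 ≤ m < l` and the `m + 2(l-m) + 1`
classes `[β-(l-m)α]_d, …, [(l-m)α]_d` exhaust the `d/c` classes of the double class of `β`. -/
def IsFamily3 (n : ℕ) [NeZero n] (M : Matrix (ZMod n) (ZMod n) ℤ) : Prop :=
  ∃ (d α β l c : ℕ) (γ : Fin (c - 1) → ℕ),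
    d ∣ n ∧ c = Nat.gcd d α ∧ 1 ≤ l ∧ l < d / c ∧
    (∀ j j', γ j ≡ γ j' [MOD c] → j = j') ∧ (∀ j, ¬ γ j ≡ β [MOD c]) ∧
    ((∃ j, (α : ZMod n) ∈ resClassClass (γ j : ZMod n) (c : ZMod n) (d : ZMod n)) ∨
      (∃ m : ℕ, 1 ≤ m ∧ m < l ∧
        (β : ZMod n) ∈ resClass (-((m : ZMod n) * (α : ZMod n))) (d : ZMod n) ∧
        d / c ≤ m + 2 * (l - m) + 1)) ∧
    M = ∑ j, PClassClass n (γ j) c d + P n ^ β + ∑ t ∈ Finset.Icc 1 l, PClass n (β + t * α) d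

end BipCirc

open BipCirc

/-!
A row that forces a column has `k - 1` black neighbours. Hence in a circulant graph with exponent
set `S` of size `k` the first force by a row needs `k - 1` black columns and the first force by a
column needs `k - 1` black rows, so that `Z(G) ≥ 2(k - 1)`. If the bound is attained, then the black
columns lie in the neighbourhood of a row and the black rows in that of a column, and after a
translation the rows `w - S` and the columns `S` form a zero forcing set for some `w ∈ S`. In
particular `S` is expanding: whenever the black columns are a proper superset of `S`, some row
forces.

If the row `r` forces `b` when `S` is black, then adding `r` maps `S \ {b}` into `S`, so that `S`
meets the coset `b + ⟨r⟩` in an arithmetic progression and is a union of cosets of `⟨r⟩` elsewhere.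
When `r` generates the group, `S` is a progression; when `S` contains all other cosets, its
complement is one. These are the first two families. Otherwise the saturation of `S` by `H = ⟨r⟩` is
proper, so some row forces when it is black, and by periodicity the forced column corresponds to an
element of `S` that is alone in its coset. Taking `H` maximal such that `b` is alone in `b + H` and
`S` is `H`-periodic elsewhere, the same argument modulo `H` gives the third family. When its classes
lie in the single coset `H + ⟨α⟩ = ℤ/nℤ`, an explicit `H`-periodic stalled pair of rows and columns
shows that the order of `α` modulo `H` is at most `2l`, which gives condition (b) with `m = 1`.

Conversely, for a progression rows and columns force alternately. In the other two families a set of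
rows with a common neighbour forces all remaining columns one class after another, and the exchange
of rows and columns turns this into a forcing of the rows.
-/

namespace BipCirc

/-! ### Stalled sets -/

section ZeroForcing

variable {V W : Type*} {G : SimpleGraph V} {H : SimpleGraph W}

/-- No force is possible from the set `X` of black vertices. -/
def IsStalled (G : SimpleGraph V) (X : Set V) : Prop :=
  ∀ u ∈ X, ∀ w, G.Adj u w → (∀ x, G.Adj u x → x ≠ w → x ∈ X) → w ∈ X

theorem isZeroForcingSet_iff_forall_isStalled [Finite V] {B : Set V} :
    IsZeroForcingSet G B ↔ ∀ X, IsStalled G X → B ⊆ X → X = Set.univ := by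
  constructor
  · intro hB X hX
    induction hB using Relation.ReflTransGen.head_induction_on with
    | refl => exact Set.univ_subset_iff.1
    | head step _ ih =>
      intro hBX
      obtain ⟨u, hu, w, -, huw, huniq, rfl⟩ := step
      refine ih (Set.insert_subset (hX u (hBX hu) w huw fun x hux hxw => ?_) hBX)
      exact by_contra fun hxX => hxw (huniq x hux fun hxB => hxX (hBX hxB))
  · induction hm : Bᶜ.ncard using Nat.strong_induction_on generalizing B with
    | _ m ih =>
      intro hstalled
      obtain rfl | hB := eq_or_ne B Set.univ
      · exact .refl
      have hforce : ¬ IsStalled G B := fun h => hB (hstalled B h subset_rfl)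
      simp only [IsStalled, not_forall] at hforce
      obtain ⟨u, hu, w, huw, huniq, hw⟩ := hforce
      refine .head (b := insert w B)
        ⟨u, hu, w, hw, huw, fun x hux hxB => not_imp_comm.1 (huniq x hux) hxB, rfl⟩ ?_
      refine ih _ (hm ▸ Set.ncard_lt_ncard ?_ (Set.toFinite _)) rfl
        fun X hX hBX => hstalled X hX ((Set.subset_insert _ _).trans hBX)
      exact compl_lt_compl_iff_lt.2 (Set.ssubset_insert hw)

theorem zeroForcingNumber_le {B : Finset V} (hB : IsZeroForcingSet G (B : Set V)) :
    zeroForcingNumber G ≤ B.card :=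
  Nat.sInf_le ⟨B, rfl, hB⟩

theorem exists_card_eq_zeroForcingNumber [Finite V] (G : SimpleGraph V) :
    ∃ B : Finset V, B.card = zeroForcingNumber G ∧ IsZeroForcingSet G (B : Set V) := by
  have := Fintype.ofFinite V
  refine Nat.sInf_mem (s := {m | ∃ B : Finset V, B.card = m ∧ IsZeroForcingSet G (B : Set V)})
    ⟨_, Finset.univ, rfl, ?_⟩
  rw [Finset.coe_univ]
  exact .refl

theorem IsStalled.preimage (φ : G ≃g H) {X : Set W} (hX : IsStalled H X) :
    IsStalled G (φ ⁻¹' X) := by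
  refine fun u hu w huw hother => hX (φ u) hu (φ w) (φ.map_adj_iff.2 huw) fun y huy hyw => ?_
  have hy : φ.symm y ∈ φ ⁻¹' X := by
    refine hother _ (φ.map_adj_iff.1 ?_) ?_
    · rwa [φ.apply_symm_apply]
    · rintro rfl
      exact hyw (φ.apply_symm_apply y).symm
  rwa [Set.mem_preimage, φ.apply_symm_apply] at hy

theorem zeroForcingNumber_le_of_iso [Finite V] [Finite W] (φ : G ≃g H) :
    zeroForcingNumber H ≤ zeroForcingNumber G := by
  obtain ⟨B, hcard, hB⟩ := exists_card_eq_zeroForcingNumber G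
  rw [← hcard, ← Finset.card_map φ.toEquiv.toEmbedding]
  refine zeroForcingNumber_le (isZeroForcingSet_iff_forall_isStalled.2 fun X hX hBX => ?_)
  have hpre := isZeroForcingSet_iff_forall_isStalled.1 hB _ (hX.preimage φ) fun v hv =>
    hBX (Finset.mem_map_of_mem φ.toEquiv.toEmbedding hv)
  exact Set.eq_univ_of_univ_subset ((φ.surjective.preimage_subset_preimage_iff).1 hpre.ge)

theorem zeroForcingNumber_congr [Finite V] [Finite W] (φ : G ≃g H) :
    zeroForcingNumber G = zeroForcingNumber H :=
  (zeroForcingNumber_le_of_iso φ.symm).antisymm (zeroForcingNumber_le_of_iso φ)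

theorem zeroForcingNumber_pos [Finite V] [Nonempty V] : 0 < zeroForcingNumber G := by
  obtain ⟨B, hcard, hB⟩ := exists_card_eq_zeroForcingNumber G
  rw [← hcard, Finset.card_pos, Finset.nonempty_iff_ne_empty]
  rintro rfl
  exact Set.empty_ne_univ (isZeroForcingSet_iff_forall_isStalled.1 hB ∅
    (fun u hu => hu.elim) (by simp))

end ZeroForcing

/-! ### Circulant matrices of sets -/

section CirculantMatrix

variable {G : Type*} [AddCommGroup G] {S R C : Set G} {r s : G}

/-- The circulant (0,1)-matrix of a subset `S` of a group, with entry `1` at `(i, j)` if and only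
if `j - i ∈ S`; over `ℤ/nℤ` it is the sum of `P ^ x` over `x ∈ S`. -/
noncomputable def circMat (S : Set G) : Matrix G G ℤ :=
  Matrix.of fun i j => S.indicator 1 (j - i)

theorem circMat_apply_eq_one {i j : G} : circMat S i j = 1 ↔ j - i ∈ S := by
  by_cases h : j - i ∈ S <;> simp [circMat, h]

theorem isZeroOne_circMat (S : Set G) : IsZeroOne (circMat S) := by
  intro i j
  by_cases h : j - i ∈ S <;> simp [circMat, h]

/-- Row `r` has `r + s` as its only white neighbour in the bipartite graph of `circMat S` when
`C` is the set of black columns. -/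
def Forces (S C : Set G) (r s : G) : Prop :=
  s ∈ S ∧ r + s ∉ C ∧ ∀ t ∈ S, t ≠ s → r + t ∈ C

/-- No row in `R` can force a column when the black columns are those in `C`. -/
def IsRowStalled (S R C : Set G) : Prop :=
  ∀ r ∈ R, ∀ s, ¬ Forces S C r s

open scoped Pointwise in
/-- The black rows `R` and black columns `C` allow no force in the bipartite graph of `circMat S`.
Negation exchanges the neighbourhood `r + S` of a row and the neighbourhood `v - S` of a column,
so forces by columns are forces by rows for the negated sets. -/
def IsStalledPair (S R C : Set G) : Prop :=
  IsRowStalled S R C ∧ IsRowStalled S (-C) (-R)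

/-- The black rows `R` and black columns `C` form a zero forcing set in the bipartite graph of
`circMat S`, for finite `G`. -/
def IsForcingPair (S R C : Set G) : Prop :=
  ∀ R' C', IsStalledPair S R' C' → R ⊆ R' → C ⊆ C' → R' = Set.univ ∧ C' = Set.univ

theorem IsRowStalled.add_mem (h : IsRowStalled S R C) (hr : r ∈ R) (hs : s ∈ S)
    (hC : ∀ t ∈ S, t ≠ s → r + t ∈ C) : r + s ∈ C :=
  by_contra fun hrs => h r hr s ⟨hs, hrs, hC⟩

theorem IsRowStalled.preimage_add_left (h : IsRowStalled S R C) (a : G) :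
    IsRowStalled S ((a + ·) ⁻¹' R) ((a + ·) ⁻¹' C) := by
  refine fun r hr s hs => h (a + r) hr s ?_
  simpa only [Forces, Set.mem_preimage, ← add_assoc] using hs

theorem IsRowStalled.isStalledPair_univ (h : IsRowStalled S Set.univ C) :
    IsStalledPair S Set.univ C :=
  ⟨h, fun _ _ _ hs => hs.2.1 (Set.mem_univ _)⟩

theorem IsStalledPair.preimage_sub_left (h : IsStalledPair S R C) (w : G) :
    IsStalledPair S ((w - ·) ⁻¹' C) ((w - ·) ⁻¹' R) := by
  constructor
  · convert h.2.preimage_add_left (-w) using 1 <;> ext x <;> simp [sub_eq_add_neg, add_comm]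
  · convert h.1.preimage_add_left w using 1 <;> ext x <;> simp

theorem IsForcingPair.mono {R' C' : Set G} (h : IsForcingPair S R C) (hR : R ⊆ R')
    (hC : C ⊆ C') : IsForcingPair S R' C' :=
  fun X Y hXY hX hY => h X Y hXY (hR.trans hX) (hC.trans hY)

theorem IsForcingPair.preimage_sub_left (h : IsForcingPair S R C) (w : G) :
    IsForcingPair S ((w - ·) ⁻¹' C) ((w - ·) ⁻¹' R) := by
  intro X Y hXY hX hY
  have hinv : ∀ Z : Set G, (w - ·) ⁻¹' ((w - ·) ⁻¹' Z) = Z := fun Z => by ext; simp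
  have huniv := h _ _ (hXY.preimage_sub_left w) (hinv R ▸ Set.preimage_mono hY)
    (hinv C ▸ Set.preimage_mono hX)
  rw [← hinv X, ← hinv Y, huniv.1, huniv.2]
  exact ⟨rfl, rfl⟩

theorem IsForcingPair.preimage_add_left (h : IsForcingPair S R C) (a : G) :
    IsForcingPair S ((a + ·) ⁻¹' R) ((a + ·) ⁻¹' C) := by
  convert (h.preimage_sub_left a).preimage_sub_left 0 using 1 <;> ext x <;> simp

open scoped Pointwise in
theorem IsForcingPair.neg (h : IsForcingPair S R C) : IsForcingPair S (-C) (-R) := by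
  convert h.preimage_sub_left 0 using 1 <;> ext x <;> simp

theorem bipGraph_circMat_adj_inl_inr {i j : G} :
    (bipGraph (circMat S)).Adj (.inl i) (.inr j) ↔ j - i ∈ S :=
  circMat_apply_eq_one

theorem isRowStalled_iff : IsRowStalled S R C ↔
    ∀ i ∈ R, ∀ j, j - i ∈ S → (∀ k, k - i ∈ S → k ≠ j → k ∈ C) → j ∈ C := by
  refine forall₂_congr fun i _ => (Equiv.addLeft i).forall_congr fun s => ?_
  have hother : (∀ k, k - i ∈ S → k ≠ i + s → k ∈ C) ↔ ∀ t ∈ S, t ≠ s → i + t ∈ C := by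
    rw [← (Equiv.addLeft i).forall_congr_right]
    simp
  rw [Equiv.coe_addLeft, hother, add_sub_cancel_left, Forces]
  tauto

open scoped Pointwise in
theorem isRowStalled_neg_iff : IsRowStalled S (-C) (-R) ↔
    ∀ i ∈ C, ∀ j, i - j ∈ S → (∀ k, i - k ∈ S → k ≠ j → k ∈ R) → j ∈ R := by
  rw [isRowStalled_iff]
  refine (Equiv.neg G).forall_congr fun i => imp_congr Iff.rfl <|
    (Equiv.neg G).forall_congr fun j => imp_congr ?_ <|
    imp_congr ((Equiv.neg G).forall_congr fun k => ?_) Iff.rfl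
  · simp [neg_add_eq_sub, sub_eq_add_neg]
  · simp [neg_add_eq_sub, sub_eq_add_neg]

theorem isStalled_bipGraph_circMat_iff {X : Set (G ⊕ G)} :
    IsStalled (bipGraph (circMat S)) X ↔ IsStalledPair S (Sum.inl ⁻¹' X) (Sum.inr ⁻¹' X) := by
  have hadj : ∀ i j : G, (bipGraph (circMat S)).Adj (.inr i) (.inl j) ↔ i - j ∈ S :=
    fun i j => (SimpleGraph.adj_comm ..).trans bipGraph_circMat_adj_inl_inr
  have hnot : ∀ i j : G, ¬ (bipGraph (circMat S)).Adj (.inl i) (.inl j) ∧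
    ¬ (bipGraph (circMat S)).Adj (.inr i) (.inr j) := fun i j => ⟨id, id⟩
  rw [IsStalledPair, isRowStalled_iff, isRowStalled_neg_iff]
  simp [IsStalled, Sum.forall, bipGraph_circMat_adj_inl_inr, hadj, hnot]

theorem isZeroForcingSet_bipGraph_circMat_iff [Finite G] {B : Set (G ⊕ G)} :
    IsZeroForcingSet (bipGraph (circMat S)) B ↔
      IsForcingPair S (Sum.inl ⁻¹' B) (Sum.inr ⁻¹' B) := by
  simp only [isZeroForcingSet_iff_forall_isStalled, isStalled_bipGraph_circMat_iff]
  constructor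
  · intro h R C hRC hR hC
    have huniv := h (Sum.elim R C) hRC (by
      rintro (x | x) hx
      exacts [hR hx, hC hx])
    exact ⟨congrArg (Sum.inl ⁻¹' ·) huniv, congrArg (Sum.inr ⁻¹' ·) huniv⟩
  · intro h X hX hBX
    obtain ⟨hR, hC⟩ := h _ _ hX (Set.preimage_mono hBX) (Set.preimage_mono hBX)
    refine Set.eq_univ_of_forall (Sum.forall.2 ⟨?_, ?_⟩)
    exacts [Set.eq_univ_iff_forall.1 hR, Set.eq_univ_iff_forall.1 hC]

end CirculantMatrix

/-! ### The lower bound `2 (k - 1)` -/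

section Bound

variable {G : Type*} [AddCommGroup G] {S R C : Set G} {r s : G}

theorem IsForcingPair.exists_forces (h : IsForcingPair S R C) (hC : C ≠ Set.univ) :
    ∃ r s, Forces S C r s := by
  by_contra! hcon
  exact hC (h _ _ (IsRowStalled.isStalledPair_univ fun r _ => hcon r) (Set.subset_univ _)
    subset_rfl).2

theorem Forces.image_subset (h : Forces S C r s) : (r + ·) '' (S \ {s}) ⊆ C := by
  rintro _ ⟨t, ht, rfl⟩
  exact h.2.2 t ht.1 ht.2

theorem Forces.ncard_image (h : Forces S C r s) :
    ((r + ·) '' (S \ {s})).ncard = S.ncard - 1 := by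
  rw [Set.ncard_image_of_injective _ (add_right_injective r), Set.ncard_sdiff_singleton_of_mem h.1]

variable [Finite G]

theorem Forces.ncard_sub_one_le (h : Forces S C r s) : S.ncard - 1 ≤ C.ncard :=
  h.ncard_image ▸ Set.ncard_le_ncard h.image_subset

theorem Forces.sub_mem (h : Forces S C r s) (hC : C.ncard = S.ncard - 1) {x : G} (hx : x ∈ C) :
    x - r ∈ S := by
  rw [← Set.eq_of_subset_of_ncard_le h.image_subset (h.ncard_image ▸ hC.le)] at hx
  obtain ⟨t, ht, rfl⟩ := hx
  simpa only [add_sub_cancel_left] using ht.1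

theorem IsForcingPair.ncard_sub_one_le (h : IsForcingPair S R C) : S.ncard - 1 ≤ C.ncard := by
  obtain rfl | hC := eq_or_ne C Set.univ
  · exact (Nat.sub_le _ _).trans (Set.ncard_le_ncard (Set.subset_univ S))
  · obtain ⟨r, s, hrs⟩ := h.exists_forces hC
    exact hrs.ncard_sub_one_le

theorem ncard_inl_preimage_add_ncard_inr_preimage {α β : Type*} (B : Finset (α ⊕ β)) :
    (Sum.inl ⁻¹' (B : Set (α ⊕ β))).ncard + (Sum.inr ⁻¹' (B : Set (α ⊕ β))).ncard = B.card := by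
  rw [← Finset.card_toLeft_add_card_toRight, ← Set.ncard_coe_finset, ← Set.ncard_coe_finset]
  congr 2 <;> ext <;> simp

open scoped Pointwise in
theorem exists_isForcingPair_ncard_add_ncard_eq (S : Set G) :
    ∃ R C, IsForcingPair S R C ∧ S.ncard - 1 ≤ R.ncard ∧ S.ncard - 1 ≤ C.ncard ∧
      R.ncard + C.ncard = zeroForcingNumber (bipGraph (circMat S)) := by
  obtain ⟨B, hcard, hB⟩ := exists_card_eq_zeroForcingNumber (bipGraph (circMat S))
  have hpair := isZeroForcingSet_bipGraph_circMat_iff.1 hB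
  refine ⟨_, _, hpair, ?_, hpair.ncard_sub_one_le, hcard ▸
    ncard_inl_preimage_add_ncard_inr_preimage B⟩
  exact Set.ncard_neg (Sum.inl ⁻¹' (B : Set (G ⊕ G))) ▸ hpair.neg.ncard_sub_one_le

theorem two_mul_le_zeroForcingNumber (S : Set G) :
    2 * (S.ncard - 1) ≤ zeroForcingNumber (bipGraph (circMat S)) := by
  obtain ⟨R, C, -, hR, hC, hcard⟩ := exists_isForcingPair_ncard_add_ncard_eq S
  omega

theorem IsForcingPair.zeroForcingNumber_eq (h : IsForcingPair S R C)
    (hR : R.ncard ≤ S.ncard - 1) (hC : C.ncard ≤ S.ncard - 1) :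
    zeroForcingNumber (bipGraph (circMat S)) = 2 * (S.ncard - 1) := by
  classical
  have := Fintype.ofFinite G
  refine le_antisymm ?_ (two_mul_le_zeroForcingNumber S)
  set B : Finset (G ⊕ G) := R.toFinset.disjSum C.toFinset
  have hinl : Sum.inl ⁻¹' (B : Set (G ⊕ G)) = R := by ext; simp [B]
  have hinr : Sum.inr ⁻¹' (B : Set (G ⊕ G)) = C := by ext; simp [B]
  refine (zeroForcingNumber_le (B := B) (isZeroForcingSet_bipGraph_circMat_iff.2 ?_)).trans ?_
  · rwa [hinl, hinr]
  · rw [← ncard_inl_preimage_add_ncard_inr_preimage, hinl, hinr]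
    omega

open scoped Pointwise in
/-- If the lower bound is attained, the black rows lie in the neighbourhood of a column and the
black columns in the neighbourhood of a row; translating that row to `0` leaves this pair. -/
theorem exists_isForcingPair_of_zeroForcingNumber_eq (hS : S.ncard - 1 < Nat.card G)
    (hZ : zeroForcingNumber (bipGraph (circMat S)) = 2 * (S.ncard - 1)) :
    ∃ w ∈ S, IsForcingPair S ((w - ·) ⁻¹' S) S := by
  obtain ⟨R, C, h, hR, hC, hcard⟩ := exists_isForcingPair_ncard_add_ncard_eq S
  replace hR : R.ncard = S.ncard - 1 := by omega
  replace hC : C.ncard = S.ncard - 1 := by omega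
  have hRneg : (-R).ncard = S.ncard - 1 := by rw [Set.ncard_neg, hR]
  have hne : ∀ X : Set G, X.ncard = S.ncard - 1 → X ≠ Set.univ := by
    rintro X hX rfl
    exact hS.ne (hX ▸ Set.ncard_univ G)
  have hRow : ∀ {r s}, Forces S C r s → ∀ x ∈ C, x - r ∈ S := fun hf x hx => hf.sub_mem hC hx
  have hCol : ∀ {r s}, Forces S (-R) r s → ∀ x ∈ R, -r - x ∈ S := fun hf x hx => by
    simpa [sub_eq_add_neg, add_comm] using hf.sub_mem hRneg (Set.neg_mem_neg.2 hx)
  have hnear : ∃ r v, v - r ∈ S ∧ (∀ x ∈ C, x - r ∈ S) ∧ ∀ x ∈ R, v - x ∈ S := by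
    obtain ⟨r, s, hr⟩ := h.exists_forces (hne C hC)
    obtain ⟨v, t, hv⟩ := h.neg.exists_forces (hne _ hRneg)
    have hnot : ¬ IsStalledPair S R C := fun hst => hne C hC (h _ _ hst subset_rfl subset_rfl).2
    simp only [IsStalledPair, IsRowStalled, not_and_or, not_forall, not_not] at hnot
    rcases hnot with ⟨r', hr', _, hforce⟩ | ⟨v', hv', _, hforce⟩
    · exact ⟨r', -v, hCol hv r' hr', hRow hforce, hCol hv⟩
    · exact ⟨r, -v', hRow hr _ hv', hRow hr, hCol hforce⟩
  obtain ⟨r, v, hrv, hCr, hRv⟩ := hnear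
  refine ⟨v - r, hrv, (h.preimage_add_left r).mono (fun x hx => ?_) fun x hx => ?_⟩
  · simpa only [Set.mem_preimage, sub_sub] using hRv _ hx
  · simpa only [add_sub_cancel_left] using hCr _ hx

end Bound

/-! ### The structure of expanding sets -/

section Structure

variable {G : Type*} [AddCommGroup G] {S D : Set G} {H : AddSubgroup G} {b g h r x α : G} {l : ℕ}

/-- Every proper superset of `S`, taken as the set of black columns, lets some row force. -/
def IsExpanding (S : Set G) : Prop :=
  ∀ C, S ⊆ C → C ≠ Set.univ → ∃ r s, Forces S C r s

theorem IsForcingPair.isExpanding {R : Set G} (h : IsForcingPair S R S) : IsExpanding S :=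
  fun _ hC hne => (h.mono subset_rfl hC).exists_forces hne

/-- The arithmetic progression `b, b + x, …, b + l • x`. -/
def progression (b x : G) (l : ℕ) : Set G :=
  {g | ∃ t ≤ l, g = b + t • x}

/-- Outside the coset `b + H`, the set `S` is a union of cosets of `H`; compare the quasi-periodic
decompositions of Kemperman. -/
def IsQuasiperiodic (H : AddSubgroup G) (S : Set G) (b : G) : Prop :=
  ∀ g ∈ S, g - b ∉ H → ∀ h ∈ H, g + h ∈ S

/-- `S` consists of the single element `b` of `b + H` and of cosets of `H` other than `b + H`. -/
def IsIsolated (H : AddSubgroup G) (S : Set G) (b : G) : Prop :=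
  b ∈ S ∧ IsQuasiperiodic H S b ∧ ∀ g ∈ S, g - b ∈ H → g = b

/-- The set of exponents in the third family: `b`, the `l` cosets `b + t • α + H` with
`1 ≤ t ≤ l`, and all cosets of `H` outside `b + H + ⟨α⟩`. -/
def classSet (H : AddSubgroup G) (b α : G) (l : ℕ) : Set G :=
  {g | g - b ∉ H ⊔ .zmultiples α ∨ g = b ∨ ∃ t, 1 ≤ t ∧ t ≤ l ∧ g - b - t • α ∈ H}

/-- The union of the cosets of `H` that meet `S`. -/
def saturation (H : AddSubgroup G) (S : Set G) : Set G :=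
  {g | ∃ s ∈ S, (s : G ⧸ H) = g}

theorem subset_saturation : S ⊆ saturation H S :=
  fun s hs => ⟨s, hs, rfl⟩

theorem add_mem_saturation (hg : g ∈ saturation H S) (hh : h ∈ H) : g + h ∈ saturation H S := by
  obtain ⟨s, hs, hsg⟩ := hg
  exact ⟨s, hs, by rw [QuotientAddGroup.mk_add_of_mem g hh, hsg]⟩

theorem IsQuasiperiodic.mem_of_mem_saturation (hq : IsQuasiperiodic H S b)
    (hg : g ∈ saturation H S) (hgb : g - b ∉ H) : g ∈ S := by
  obtain ⟨s, hs, hsg⟩ := hg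
  have hgs : g - s ∈ H := QuotientAddGroup.eq_iff_sub_mem.1 hsg.symm
  have := hq s hs (fun hsb => hgb (by simpa using add_mem hgs hsb)) _ hgs
  rwa [add_sub_cancel] at this

/-- A column outside the saturation that a row forces is the only one of its coset in the
neighbourhood of the row, so its coset is the one that `S` does not contain entirely. -/
theorem IsExpanding.exists_forces_saturation (hE : IsExpanding S) (hq : IsQuasiperiodic H S b)
    (hH : H ≠ ⊥) (hb : b ∈ S) (hout : ∃ g ∉ S, g - b ∉ H) :
    IsIsolated H S b ∧ ∃ r, Forces S (saturation H S) r b := by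
  obtain ⟨g, hg, hgb⟩ := hout
  obtain ⟨r, s, hrs⟩ := hE (saturation H S) subset_saturation fun huniv =>
    hg (hq.mem_of_mem_saturation (huniv ▸ Set.mem_univ g) hgb)
  have halone : ∀ t ∈ S, t - s ∈ H → t = s := fun t ht hts => by_contra fun hne => hrs.2.1 <| by
    simpa using add_mem_saturation (hrs.2.2 t ht hne) (neg_mem hts)
  have hsb : s - b ∈ H := by
    obtain ⟨h, hh, hne⟩ := (AddSubgroup.bot_or_exists_ne_zero H).resolve_left hH
    exact by_contra fun hsb => hne <| by
      simpa using halone (s + h) (hq s hrs.1 hsb h hh) (by simpa using hh)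
  obtain rfl : b = s := halone b hb (by simpa using neg_mem hsb)
  exact ⟨⟨hb, hq, halone⟩, r, hrs⟩

theorem isQuasiperiodic_zmultiples [Finite G] (hD : ∀ g ∈ D, g ≠ b → g - α ∈ D) :
    IsQuasiperiodic (.zmultiples α) D b := by
  intro g hg hgb k hk
  have hsub : ∀ t : ℕ, g - t • α ∈ D := by
    intro t
    induction t with
    | zero => simpa using hg
    | succ t ih =>
      have := hD _ ih fun h => hgb ⟨t, by simp [← h]⟩
      rwa [sub_sub, ← succ_nsmul] at this
  obtain ⟨t, ht⟩ := mem_multiples_iff_mem_zmultiples.2 (neg_mem hk)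
  have := hsub t
  rwa [show t • α = -k from ht, sub_neg_eq_add] at this

theorem exists_mem_iff_mem_progression [Finite G] (hb : b ∈ D) (hbα : b - α ∉ D)
    (hD : ∀ g ∈ D, g ≠ b → g - α ∈ D) : ∃ l, l + 1 < addOrderOf α ∧
      ∀ g, g - b ∈ AddSubgroup.zmultiples α → (g ∈ D ↔ g ∈ progression b α l) := by
  classical
  have hlast : b + (addOrderOf α - 1) • α ∉ D := by
    rwa [sub_nsmul _ (addOrderOf_pos α), addOrderOf_nsmul_eq_zero, one_nsmul, zero_add,
      ← sub_eq_add_neg]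
  have hex : ∃ t : ℕ, b + t • α ∉ D := ⟨_, hlast⟩
  obtain ⟨l, hl⟩ : ∃ l, Nat.find hex = l + 1 :=
    Nat.exists_eq_succ_of_ne_zero fun h => Nat.find_spec hex (by simpa [h] using hb)
  have hmem : ∀ t ≤ l, b + t • α ∈ D := fun t ht =>
    not_not.1 (Nat.find_min hex (hl ▸ Nat.lt_succ_of_le ht))
  have hnotMem : ∀ t, l + 1 ≤ t → t < addOrderOf α → b + t • α ∉ D := by
    intro t hlt
    induction t, hlt using Nat.le_induction with
    | base => exact fun _ => hl ▸ Nat.find_spec hex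
    | succ t _ ih =>
      refine fun ht hD' => ih (by omega) ?_
      have := hD _ hD' fun h => nsmul_ne_zero_of_lt_addOrderOf t.succ_ne_zero ht (by simpa using h)
      rwa [succ_nsmul, ← add_assoc, add_sub_cancel_right] at this
  have hle : l + 1 ≤ addOrderOf α - 1 := hl ▸ Nat.find_min' hex hlast
  refine ⟨l, by omega, fun g hg => ⟨fun hgD => ?_, ?_⟩⟩
  · obtain ⟨t, ht, htg⟩ := Finset.mem_image.1 (mem_zmultiples_iff_mem_range_addOrderOf.1 hg)
    obtain rfl : b + t • α = g := by rw [htg, add_sub_cancel]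
    exact ⟨t, by_contra fun h => hnotMem t (by omega) (Finset.mem_range.1 ht) hgD, rfl⟩
  · rintro ⟨t, ht, rfl⟩
    exact hmem t ht

theorem compl_eq_progression [Finite G] (hl : l + 1 < addOrderOf x)
    (hprog : ∀ g, g - b ∈ AddSubgroup.zmultiples x → (g ∈ S ↔ g ∈ progression b x l))
    (hrest : ∀ g, g - b ∉ AddSubgroup.zmultiples x → g ∈ S) :
    Sᶜ = progression (b + (l + 1) • x) x (addOrderOf x - (l + 2)) := by
  classical
  ext g
  rw [Set.mem_compl_iff]
  constructor
  · intro hg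
    have hgx : g - b ∈ AddSubgroup.zmultiples x := by_contra fun h => hg (hrest g h)
    obtain ⟨t, ht, htg⟩ := Finset.mem_image.1 (mem_zmultiples_iff_mem_range_addOrderOf.1 hgx)
    obtain rfl : b + t • x = g := by rw [htg, add_sub_cancel]
    have hlt : l < t := by_contra fun h => hg ((hprog _ hgx).2 ⟨t, by omega, rfl⟩)
    have := Finset.mem_range.1 ht
    refine ⟨t - (l + 1), by omega, ?_⟩
    rw [add_assoc, ← add_nsmul, Nat.add_sub_cancel' hlt]
  · rintro ⟨t, ht, rfl⟩ hmem
    obtain ⟨u, hu, heq⟩ := (hprog _ ⟨(l + 1 + t : ℕ), by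
      simp only [natCast_zsmul, add_nsmul]; abel⟩).1 hmem
    rw [add_assoc, ← add_nsmul, add_right_inj] at heq
    have := nsmul_injOn_Iio_addOrderOf (Set.mem_Iio.2 (by omega)) (Set.mem_Iio.2 (by omega)) heq
    omega

theorem coe_mem_zmultiples_iff_mem_sup :
    (g : G ⧸ H) ∈ AddSubgroup.zmultiples (α : G ⧸ H) ↔ g ∈ H ⊔ .zmultiples α := by
  rw [← QuotientAddGroup.mk'_apply, ← QuotientAddGroup.mk'_apply, ← AddMonoidHom.map_zmultiples,
    ← AddSubgroup.mem_comap, AddSubgroup.comap_map_eq, QuotientAddGroup.ker_mk', sup_comm]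

theorem coe_eq_add_nsmul_iff (t : ℕ) :
    (g : G ⧸ H) = b + t • (α : G ⧸ H) ↔ g - b - t • α ∈ H := by
  rw [sub_sub, ← QuotientAddGroup.eq_iff_sub_mem, QuotientAddGroup.mk_add,
    QuotientAddGroup.mk_nsmul]

theorem coe_mem_progression_iff :
    (g : G ⧸ H) ∈ progression (b : G ⧸ H) (α : G ⧸ H) l ↔ ∃ t ≤ l, g - b - t • α ∈ H :=
  exists_congr fun t => and_congr_right fun _ => coe_eq_add_nsmul_iff t

/-- Modulo `H`, a row that can force `b` shows that the saturation of `S` is closed under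
subtracting `α`, except at the class of `b`. -/
theorem IsIsolated.exists_classes [Finite G] (hiso : IsIsolated H S b)
    (hf : Forces S (saturation H S) r b) : ∃ l, l + 1 < addOrderOf ((-r : G) : G ⧸ H) ∧
      IsQuasiperiodic (H ⊔ .zmultiples (-r)) S b ∧
      ∀ g, g - b ∈ H ⊔ .zmultiples (-r) →
        (g ∈ saturation H S ↔ ∃ t ≤ l, g - b - t • (-r) ∈ H) := by
  set D : Set (G ⧸ H) := (↑) '' S
  have hsat : ∀ g : G, (g : G ⧸ H) ∈ D ↔ g ∈ saturation H S := fun _ => Iff.rfl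
  have hstep : ∀ d ∈ D, d ≠ (b : G ⧸ H) → d - ((-r : G) : G ⧸ H) ∈ D := by
    rintro _ ⟨t, ht, rfl⟩ htb
    rw [← QuotientAddGroup.mk_sub, hsat, sub_neg_eq_add, add_comm]
    exact hf.2.2 t ht (ne_of_apply_ne _ htb)
  have hb : (b : G ⧸ H) - ((-r : G) : G ⧸ H) ∉ D := by
    rw [← QuotientAddGroup.mk_sub, hsat, sub_neg_eq_add, add_comm]
    exact hf.2.1
  obtain ⟨l, hl, hprog⟩ := exists_mem_iff_mem_progression
    (Set.mem_image_of_mem _ hf.1) hb hstep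
  refine ⟨l, hl, fun g hg hgb k hk => ?_, fun g hg => ?_⟩
  · refine hiso.2.1.mem_of_mem_saturation ((hsat _).1 ?_) fun hmem => hgb ?_
    · rw [QuotientAddGroup.mk_add]
      refine isQuasiperiodic_zmultiples hstep _ ((hsat g).2 (subset_saturation hg)) ?_ _
        (coe_mem_zmultiples_iff_mem_sup.2 hk)
      rwa [← QuotientAddGroup.mk_sub, coe_mem_zmultiples_iff_mem_sup]
    · have := sub_mem (AddSubgroup.mem_sup_left hmem) hk
      rwa [add_sub_right_comm, add_sub_cancel_right] at this
  · rw [← coe_mem_progression_iff, ← hprog g (by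
      rwa [← QuotientAddGroup.mk_sub, coe_mem_zmultiples_iff_mem_sup]), hsat]

theorem IsIsolated.mem_classSet_iff (hiso : IsIsolated H S b)
    (hl : l + 1 < addOrderOf (α : G ⧸ H))
    (hclass : ∀ g, g - b ∈ H ⊔ .zmultiples α →
      (g ∈ saturation H S ↔ ∃ t ≤ l, g - b - t • α ∈ H)) (hg : g - b ∈ H ⊔ .zmultiples α) :
    g ∈ S ↔ g ∈ classSet H b α l := by
  constructor
  · intro hgS
    obtain ⟨t, ht, hgt⟩ := (hclass g hg).1 (subset_saturation hgS)
    obtain rfl | hpos := t.eq_zero_or_pos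
    · exact .inr (.inl (hiso.2.2 g hgS (by simpa using hgt)))
    · exact .inr (.inr ⟨t, hpos, ht, hgt⟩)
  · rintro (h | rfl | ⟨t, hpos, ht, hgt⟩)
    · exact (h hg).elim
    · exact hiso.1
    · refine hiso.2.1.mem_of_mem_saturation ((hclass g hg).2 ⟨t, ht, hgt⟩) fun hgb => ?_
      refine nsmul_ne_zero_of_lt_addOrderOf (x := (α : G ⧸ H)) (Nat.one_le_iff_ne_zero.1 hpos)
        (by omega) ?_
      rw [← QuotientAddGroup.mk_nsmul, QuotientAddGroup.eq_zero_iff]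
      simpa using sub_mem hgb hgt

/-- If `H` is maximal, then `b` is not isolated modulo `H ⊔ ⟨α⟩`, so that every coset of this
larger group other than that of `b` lies in `S`. -/
theorem IsExpanding.eq_classSet_of_maximal [Finite G] (hE : IsExpanding S)
    (hH : Maximal (fun H => H ≠ ⊥ ∧ IsIsolated H S b) H) (hout : ∃ g ∉ S, g - b ∉ H) :
    ∃ (α : G) (l : ℕ), 1 ≤ l ∧ l + 1 < addOrderOf (α : G ⧸ H) ∧ S = classSet H b α l := by
  obtain ⟨hbot, hiso⟩ := hH.prop
  obtain ⟨-, r, hf⟩ := hE.exists_forces_saturation hiso.2.1 hbot hiso.1 hout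
  obtain ⟨l, hl, hquasi, hclass⟩ := hiso.exists_classes hf
  set α := -r
  set K := H ⊔ .zmultiples α
  have hKbot : K ≠ ⊥ := ne_bot_of_le_ne_bot hbot le_sup_left
  have hnot : ¬ IsIsolated K S b := fun hK => by
    have hα : α ∈ H := hH.le_of_ge ⟨hKbot, hK⟩ le_sup_left
      (AddSubgroup.mem_sup_right (AddSubgroup.mem_zmultiples α))
    rw [(QuotientAddGroup.eq_zero_iff α).2 hα, addOrderOf_zero] at hl
    omega
  have hrest : ∀ g, g - b ∉ K → g ∈ S := by
    by_contra! ⟨g, hgb, hg⟩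
    exact hnot (hE.exists_forces_saturation hquasi hKbot hiso.1 ⟨g, hg, hgb⟩).1
  refine ⟨α, l, Nat.one_le_iff_ne_zero.2 ?_, hl, Set.ext fun g => ?_⟩
  · rintro rfl
    refine hnot ⟨hiso.1, hquasi, fun g hg hgK => hiso.2.2 g hg ?_⟩
    obtain ⟨t, ht, hgt⟩ := (hclass g hgK).1 (subset_saturation hg)
    obtain rfl : t = 0 := by omega
    simpa using hgt
  · by_cases hgK : g - b ∈ K
    · exact hiso.mem_classSet_iff hl hclass hgK
    · exact iff_of_true (hrest g hgK) (.inl hgK)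

theorem IsIsolated.exists_compl_eq_progression [Finite G] [IsAddCyclic G] (hiso : IsIsolated H S b)
    (hbot : H ≠ ⊥) (htop : H ≠ ⊤) (hrest : ∀ g, g - b ∉ H → g ∈ S) :
    ∃ a x l, AddSubgroup.zmultiples x ≠ ⊤ ∧ l + 1 < addOrderOf x ∧ Sᶜ = progression a x l := by
  obtain ⟨x, rfl⟩ := H.isAddCyclic_iff_exists_zmultiples_eq_top.1 inferInstance
  have hord : 0 + 1 < addOrderOf x := by
    have hpos := addOrderOf_pos x
    have hne := mt AddMonoid.addOrderOf_eq_one_iff.1 (mt AddSubgroup.zmultiples_eq_bot.2 hbot)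
    omega
  refine ⟨_, x, _, htop, ?_, compl_eq_progression hord (fun g hg => ⟨fun hgS => ?_, ?_⟩)
    hrest⟩
  · omega
  · exact ⟨0, le_rfl, by simpa using hiso.2.2 g hgS hg⟩
  · rintro ⟨t, ht, rfl⟩
    obtain rfl : t = 0 := by omega
    simpa using hiso.1

theorem IsExpanding.exists_progression_or_isIsolated [Finite G] (hE : IsExpanding S)
    (hS : S ≠ Set.univ) :
    (∃ b x l, AddSubgroup.zmultiples x = ⊤ ∧ l + 1 < addOrderOf x ∧ S = progression b x l) ∨
    (∃ a x l, AddSubgroup.zmultiples x ≠ ⊤ ∧ l + 1 < addOrderOf x ∧ Sᶜ = progression a x l) ∨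
    ∃ b H, H ≠ ⊥ ∧ IsIsolated H S b := by
  obtain ⟨r, b, hb, hrb, hf⟩ := hE S subset_rfl hS
  have hstep : ∀ g ∈ S, g ≠ b → g - (-r) ∈ S := fun g hg hne => by
    simpa [add_comm] using hf g hg hne
  obtain ⟨l, hl, hprog⟩ := exists_mem_iff_mem_progression hb (by simpa [add_comm] using hrb) hstep
  have hquasi := isQuasiperiodic_zmultiples hstep
  set x := -r
  by_cases htop : AddSubgroup.zmultiples x = ⊤
  · exact .inl ⟨b, x, l, htop, hl, Set.ext fun g => hprog g (htop ▸ AddSubgroup.mem_top _)⟩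
  by_cases hrest : ∀ g, g - b ∉ AddSubgroup.zmultiples x → g ∈ S
  · exact .inr (.inl ⟨_, x, _, htop, by omega, compl_eq_progression hl hprog hrest⟩)
  · push Not at hrest
    obtain ⟨g, hgb, hg⟩ := hrest
    have hx : AddSubgroup.zmultiples x ≠ ⊥ := fun h => by
      rw [AddSubgroup.zmultiples_eq_bot] at h
      rw [h, addOrderOf_zero] at hl
      omega
    exact .inr (.inr ⟨b, _, hx, (hE.exists_forces_saturation hquasi hx hb ⟨g, hg, hgb⟩).1⟩)

theorem IsExpanding.exists_structure [Finite G] [IsAddCyclic G] (hE : IsExpanding S)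
    (hS : S.Nontrivial) (huniv : S ≠ Set.univ) :
    (∃ b x l, AddSubgroup.zmultiples x = ⊤ ∧ l + 1 < addOrderOf x ∧ S = progression b x l) ∨
    (∃ a x l, AddSubgroup.zmultiples x ≠ ⊤ ∧ l + 1 < addOrderOf x ∧ Sᶜ = progression a x l) ∨
    ∃ (H : AddSubgroup G) (b α : G) (l : ℕ), H ≠ ⊥ ∧ 1 ≤ l ∧
      l + 1 < addOrderOf (α : G ⧸ H) ∧ S = classSet H b α l := by
  obtain h | h | ⟨b, hisolated⟩ := hE.exists_progression_or_isIsolated huniv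
  · exact .inl h
  · exact .inr (.inl h)
  obtain ⟨H, hmax⟩ := (Set.toFinite {H | H ≠ ⊥ ∧ IsIsolated H S b}).exists_maximal hisolated
  obtain ⟨hbot, hiso⟩ := hmax.prop
  by_cases hrest : ∀ g, g - b ∉ H → g ∈ S
  · obtain ⟨s, hs, hsb⟩ := hS.exists_ne b
    have htop : H ≠ ⊤ := fun h => hsb (hiso.2.2 s hs (h ▸ AddSubgroup.mem_top _))
    exact .inr (.inl (hiso.exists_compl_eq_progression hbot htop hrest))
  · push Not at hrest
    obtain ⟨g, hgb, hg⟩ := hrest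
    obtain ⟨α, l, h⟩ := hE.eq_classSet_of_maximal hmax ⟨g, hg, hgb⟩
    exact .inr (.inr ⟨H, b, α, l, hbot, h⟩)

end Structure

/-! ### A necessary condition on the third family -/

section Necessary

variable {G : Type*} [AddCommGroup G] {S C Y : Set G} {H : AddSubgroup G} {b g w α : G} {l : ℕ}

theorem mem_classSet_iff_coe (htop : H ⊔ .zmultiples α = ⊤) : g ∈ classSet H b α l ↔
    g = b ∨ ∃ t, 1 ≤ t ∧ t ≤ l ∧ (g : G ⧸ H) = b + t • (α : G ⧸ H) := by
  simp only [classSet, Set.mem_ofPred_eq, htop, AddSubgroup.mem_top, not_true_eq_false, false_or,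
    coe_eq_add_nsmul_iff]

theorem isIsolated_classSet (hl : l < addOrderOf (α : G ⧸ H)) :
    IsIsolated H (classSet H b α l) b := by
  refine ⟨.inr (.inl rfl), fun g hg hgb h hh => ?_, fun g hg hgb => ?_⟩
  · obtain hg | rfl | ⟨t, h1, hl, hgt⟩ := hg
    · refine .inl fun hgh => hg ?_
      have := sub_mem hgh (AddSubgroup.mem_sup_left hh)
      rwa [add_sub_right_comm, add_sub_cancel_right] at this
    · exact (hgb (by simp)).elim
    · refine .inr (.inr ⟨t, h1, hl, ?_⟩)
      rw [add_sub_right_comm, add_sub_right_comm]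
      exact add_mem hgt hh
  · obtain hg | rfl | ⟨t, h1, htl, hgt⟩ := hg
    · exact (hg (AddSubgroup.mem_sup_left hgb)).elim
    · rfl
    · refine (nsmul_ne_zero_of_lt_addOrderOf (by omega : t ≠ 0) (htl.trans_lt hl) ?_).elim
      rw [← QuotientAddGroup.mk_nsmul, QuotientAddGroup.eq_zero_iff]
      simpa using sub_mem hgb hgt

open scoped Pointwise in
/-- The pair is fixed by the reflection that exchanges the rows and the columns. -/
theorem isStalledPair_preimage_sub_left_iff :
    IsStalledPair S ((w - ·) ⁻¹' C) C ↔ IsRowStalled S ((w - ·) ⁻¹' C) C := by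
  refine ⟨And.left, fun h => ⟨h, ?_⟩⟩
  convert h.preimage_add_left w using 1 <;> ext x <;> simp

theorem IsIsolated.isRowStalled (hiso : IsIsolated H S b) (hH : H ≠ ⊥)
    (hY : ∀ g ∈ Y, ∀ h ∈ H, g + h ∈ Y) : IsRowStalled S Y ((· - b) ⁻¹' Y) := by
  obtain ⟨h, hh, hne⟩ := (AddSubgroup.bot_or_exists_ne_zero H).resolve_left hH
  rintro r hr s ⟨hs, hrs, hother⟩
  obtain rfl | hsb := eq_or_ne s b
  · exact hrs (by simpa using hr)
  · have hsh : s + h ∈ S := hiso.2.1 s hs (fun hmem => hsb (hiso.2.2 s hs hmem)) h hh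
    have := hY _ (hother (s + h) hsh (by simpa using hne)) _ (neg_mem hh)
    rw [show r + (s + h) - b + -h = r + s - b by abel] at this
    exact hrs this

open scoped Pointwise in
theorem IsIsolated.isStalledPair (hiso : IsIsolated H S b) (hH : H ≠ ⊥)
    (hY : ∀ g ∈ Y, ∀ h ∈ H, g + h ∈ Y) : IsStalledPair S Y ((· - b) ⁻¹' Y) := by
  refine ⟨hiso.isRowStalled hH hY, ?_⟩
  convert hiso.isRowStalled hH (Y := -((· - b) ⁻¹' Y)) fun g hg h hh => ?_ using 1
  · ext x
    simp
  · simpa [sub_eq_add_neg, add_assoc, add_comm, add_left_comm] using hY _ hg _ (neg_mem hh)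

/-- The neighbourhoods of the column `b` and of the row `0` are already stalled. -/
theorem isStalledPair_classSet (hH : H ≠ ⊥) (htop : H ⊔ .zmultiples α = ⊤)
    (hl : 2 * l < addOrderOf (α : G ⧸ H)) :
    IsStalledPair (classSet H b α l) ((b - ·) ⁻¹' classSet H b α l) (classSet H b α l) := by
  rw [isStalledPair_preimage_sub_left_iff]
  have hiso : IsIsolated H (classSet H b α l) b := isIsolated_classSet (by omega)
  have hne : ∀ t : ℕ, 1 ≤ t → t ≤ 2 * l → t • (α : G ⧸ H) ≠ 0 := fun t h1 ht =>
    nsmul_ne_zero_of_lt_addOrderOf (by omega) (by omega)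
  obtain ⟨h, hh, h0⟩ := (AddSubgroup.bot_or_exists_ne_zero H).resolve_left hH
  rintro r hr s ⟨hs, hrs, hother⟩
  have hr0 : r ≠ 0 := by
    rintro rfl
    exact hrs (by simpa using hs)
  obtain ⟨u, h1u, hul, hu⟩ := ((mem_classSet_iff_coe htop).1 hr).resolve_left (by simpa using hr0)
  have hrH : b - r - b ∉ H := fun hmem => hr0 (by simpa using hiso.2.2 _ hr hmem)
  have hrb : r + b ∉ classSet H b α l := by
    rw [mem_classSet_iff_coe htop]
    rintro (heq | ⟨t, h1t, htl, ht⟩)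
    · exact hr0 (by simpa using heq)
    · refine hne (t + u) (by omega) (by omega) ?_
      rw [QuotientAddGroup.mk_sub, sub_eq_add_neg, add_right_inj] at hu
      rw [QuotientAddGroup.mk_add, add_comm, add_right_inj] at ht
      rw [add_nsmul, ← hu, ← ht, add_neg_cancel]
  obtain rfl : b = s := by_contra fun hbs => hrb (hother b hiso.1 hbs)
  have hbh : b + h ∈ classSet H b α l := by
    have := hother _ (hiso.2.1 _ hr hrH h hh) fun heq => hrH ?_
    · rwa [← add_assoc, add_sub_cancel] at this
    · have : b - r - b = -h := sub_eq_iff_eq_add.2 (eq_sub_of_add_eq heq |>.trans (by abel))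
      exact this ▸ neg_mem hh
  exact h0 (by simpa using hiso.2.2 _ hbh (by simpa using hh))

theorem addOrderOf_le_of_isForcingPair [Finite G] (hH : H ≠ ⊥) (hl : 1 ≤ l)
    (htop : H ⊔ .zmultiples α = ⊤) (hw : w ∈ classSet H b α l)
    (h : IsForcingPair (classSet H b α l) ((w - ·) ⁻¹' classSet H b α l) (classSet H b α l)) :
    addOrderOf (α : G ⧸ H) ≤ 2 * l := by
  by_contra! hord
  have hiso : IsIsolated H (classSet H b α l) b := isIsolated_classSet (by omega)
  obtain rfl | ⟨a, h1a, hal, hwa⟩ := (mem_classSet_iff_coe htop).1 hw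
  · obtain ⟨k, hk, h0⟩ := (AddSubgroup.bot_or_exists_ne_zero H).resolve_left hH
    have huniv := (h _ _ (isStalledPair_classSet hH htop hord) subset_rfl subset_rfl).2
    exact h0 (by simpa using hiso.2.2 (w + k) (huniv ▸ Set.mem_univ _) (by simpa using hk))
  set Y : Set G := {g | ∃ j : ℤ, a - l ≤ j ∧ j ≤ l ∧ (g : G ⧸ H) = j • (α : G ⧸ H)}
  have hY : ∀ g ∈ Y, ∀ k ∈ H, g + k ∈ Y := by
    rintro g ⟨j, hj, hjl, hg⟩ k hk
    exact ⟨j, hj, hjl, by rw [QuotientAddGroup.mk_add_of_mem g hk, hg]⟩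
  have huniv := (h _ _ (hiso.isStalledPair hH hY) (fun g hg => ?_) fun g hg => ?_).1
  · obtain ⟨j, hj, hjl, hg⟩ : (l + 1) • α ∈ Y := huniv ▸ Set.mem_univ _
    rw [QuotientAddGroup.mk_nsmul, ← natCast_zsmul, ← sub_eq_zero, ← sub_smul] at hg
    refine nsmul_ne_zero_of_lt_addOrderOf (n := (l + 1 - j).toNat) (by omega) (by omega)
      (x := (α : G ⧸ H)) ?_
    rw [← natCast_zsmul, Int.toNat_of_nonneg (by omega)]
    exact_mod_cast hg
  · obtain hg | ⟨t, ht, htl, hg⟩ := (mem_classSet_iff_coe htop).1 hg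
    · refine ⟨a, by omega, by omega, ?_⟩
      rw [← sub_sub_cancel w g]
      simp [show w - g = b from hg, hwa]
    · refine ⟨a - t, by omega, by omega, ?_⟩
      rw [← sub_sub_cancel w g, QuotientAddGroup.mk_sub, hg, hwa]
      simp [sub_smul]
  · obtain rfl | ⟨t, ht, htl, hg⟩ := (mem_classSet_iff_coe htop).1 hg
    · exact ⟨0, by omega, by omega, by simp⟩
    · exact ⟨t, by omega, by omega, by simp [hg]⟩

end Necessary

/-! ### Sets that attain the bound -/

section Attaining

variable {G : Type*} [AddCommGroup G] {S C L : Set G} {H : AddSubgroup G} {a b g t v x α : G}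
  {l N j : ℕ}

theorem progression_eq_image : progression b x l = (fun t : ℕ => b + t • x) '' Set.Iic l := by
  ext g
  simp [progression, eq_comm]

theorem injOn_add_nsmul (b x : G) : Set.InjOn (fun t : ℕ => b + t • x) (Set.Iio (addOrderOf x)) :=
  fun _ ht _ hu h => nsmul_injOn_Iio_addOrderOf ht hu (add_left_cancel h)

theorem ncard_progression (hl : l < addOrderOf x) : (progression b x l).ncard = l + 1 := by
  rw [progression_eq_image,
    ((injOn_add_nsmul b x).mono (Set.Iic_subset_Iio.2 hl)).ncard_image, ← Finset.coe_Iic,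
    Set.ncard_coe_finset, Nat.card_Iic]

/-- Rows and columns turn black alternately, in the order of the multiples of `x`. -/
theorem isForcingPair_progression [Finite G] (hx : AddSubgroup.zmultiples x = ⊤) (hl : 1 ≤ l) :
    IsForcingPair (progression b x l) (progression 0 x (l - 1)) (progression b x (l - 1)) := by
  intro R C hRC hR hC
  have key : ∀ j : ℕ, j • x ∈ R ∧ b + j • x ∈ C := by
    intro j
    induction j using Nat.strong_induction_on with
    | _ j ih =>
      obtain hj | hj := lt_or_ge j l
      · exact ⟨hR ⟨j, by omega, (zero_add _).symm⟩, hC ⟨j, by omega, rfl⟩⟩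
      have hcol : b + j • x ∈ C := by
        have := hRC.1.add_mem (ih (j - l) (by omega)).1 (s := b + l • x) ⟨l, le_rfl, rfl⟩ ?_
        · rwa [add_left_comm, ← add_nsmul, Nat.sub_add_cancel hj] at this
        · rintro _ ⟨t, ht, rfl⟩ hne
          have : t ≠ l := by rintro rfl; exact hne rfl
          rw [add_left_comm, ← add_nsmul]
          exact (ih _ (by omega)).2
      refine ⟨?_, hcol⟩
      have := hRC.2.add_mem (Set.neg_mem_neg.2 hcol) (s := b) ⟨0, by omega, by simp⟩ ?_
      · simpa using this
      · rintro _ ⟨t, ht, rfl⟩ hne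
        have : t ≠ 0 := by rintro rfl; exact hne (by simp)
        have hrow := (ih (j - t) (by omega)).1
        rw [sub_nsmul _ (by omega)] at hrow
        rw [Set.mem_neg]
        convert hrow using 1
        abel
  have hmul : ∀ g : G, ∃ j : ℕ, j • x = g := fun g =>
    mem_multiples_iff_mem_zmultiples.2 (hx ▸ AddSubgroup.mem_top g)
  constructor <;> refine Set.eq_univ_of_forall fun g => ?_
  · obtain ⟨j, rfl⟩ := hmul g
    exact (key j).1
  · obtain ⟨j, hj⟩ := hmul (g - b)
    simpa [hj] using (key j).2

theorem zeroForcingNumber_progression [Finite G] (hx : AddSubgroup.zmultiples x = ⊤) (hl : 1 ≤ l)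
    (hlx : l < addOrderOf x) : zeroForcingNumber (bipGraph (circMat (progression b x l))) =
      2 * ((progression b x l).ncard - 1) := by
  refine (isForcingPair_progression hx hl).zeroForcingNumber_eq ?_ ?_ <;>
    rw [ncard_progression hlx, ncard_progression (by omega)] <;> omega

/-- If the rows in `L` suffice to fill the columns, and if the column `v` is adjacent to all rows
in `L`, then by symmetry the columns in `v - L` fill the rows. -/
theorem zeroForcingNumber_eq_of_forall_eq_univ [Finite G] (ht : t ∈ S)
    (hL : ∀ r ∈ L, v - r ∈ S \ {t})
    (hfill : ∀ C, S \ {t} ⊆ C → IsRowStalled S L C → C = Set.univ) :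
    zeroForcingNumber (bipGraph (circMat S)) = 2 * (S.ncard - 1) := by
  have hcard : (S \ {t}).ncard = S.ncard - 1 := Set.ncard_sdiff_singleton_of_mem ht
  have hpair : IsForcingPair S ((v - ·) ⁻¹' (S \ {t})) (S \ {t}) := by
    intro R C hRC hR hC
    refine ⟨?_, hfill C hC fun r hr => hRC.1 r (hR (hL r hr))⟩
    have hcol := hfill ((v - ·) ⁻¹' R) (fun x hx => hR (by simpa only [Set.mem_preimage,
      sub_sub_cancel] using hx)) fun r hr => (hRC.preimage_sub_left v).1 r (hC (hL r hr))
    refine Set.eq_univ_of_forall fun g => ?_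
    have hg : v - g ∈ (v - ·) ⁻¹' R := hcol ▸ Set.mem_univ _
    simpa only [Set.mem_preimage, sub_sub_cancel] using hg
  refine hpair.zeroForcingNumber_eq ?_ hcard.le
  rw [← hcard, Set.ncard_preimage_of_injective_subset_range sub_right_injective
    fun g _ => ⟨v - g, sub_sub_cancel v g⟩]

/-- The white columns lie among `a, a + x, …, a + (l + 1) • x`, and the last white one is forced by
a row whose other neighbours all lie outside this range or after it. -/
theorem eq_univ_of_isRowStalled_compl_progression
    (hC : (progression a x l)ᶜ \ {a + (l + 1) • x} ⊆ C)
    (hlast : a + (l + 1) • x ∈ (progression a x l)ᶜ)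
    (hrow : IsRowStalled (progression a x l)ᶜ (AddSubgroup.zmultiples x) C) : C = Set.univ := by
  classical
  have hwhite : ∀ c ∉ C, ∃ m ≤ l + 1, c = a + m • x := by
    intro c hc
    obtain hca | hca := or_iff_not_imp_left.2 fun h : c ∉ progression a x l =>
      of_not_not fun hne : c ≠ a + (l + 1) • x => hc (hC ⟨h, hne⟩)
    · obtain ⟨m, hm, rfl⟩ := hca
      exact ⟨m, by omega, rfl⟩
    · exact ⟨l + 1, le_rfl, hca⟩
  by_contra hne
  obtain ⟨c, hc⟩ := (Set.ne_univ_iff_exists_notMem C).1 hne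
  obtain ⟨m₀, hm₀, rfl⟩ := hwhite c hc
  set m := Nat.findGreatest (fun m => a + m • x ∉ C) (l + 1)
  have hm : m ≤ l + 1 := Nat.findGreatest_le _
  have hsub : -((l + 1 - m) • x) + (a + (l + 1) • x) = a + m • x := by
    rw [sub_nsmul _ hm]
    abel
  refine Nat.findGreatest_spec (P := fun m => a + m • x ∉ C) hm₀ hc (hsub ▸ hrow.add_mem
    (neg_mem (nsmul_mem (AddSubgroup.mem_zmultiples x) _)) hlast fun s hs hsne =>
      by_contra fun hsC => ?_)
  obtain ⟨u, hu, hsu⟩ := hwhite _ hsC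
  have hum : u ≤ m := Nat.le_findGreatest hu (hsu ▸ hsC)
  have hs_eq : s = a + (u + (l + 1 - m)) • x := by
    rw [neg_add_eq_iff_eq_add.1 hsu, add_nsmul]
    abel
  obtain rfl | hlt := hum.eq_or_lt
  · exact hsne (by rw [hs_eq, Nat.add_sub_cancel' hm])
  · exact hs ⟨_, by omega, hs_eq⟩

theorem zeroForcingNumber_compl_progression [Finite G] (hx : AddSubgroup.zmultiples x ≠ ⊤)
    (hl : l + 1 < addOrderOf x) :
    zeroForcingNumber (bipGraph (circMat (progression a x l)ᶜ)) =
      2 * ((progression a x l)ᶜ.ncard - 1) := by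
  obtain ⟨w, hw⟩ : ∃ w, w ∉ AddSubgroup.zmultiples x := by
    simpa [AddSubgroup.eq_top_iff'] using hx
  have hlast : a + (l + 1) • x ∈ (progression a x l)ᶜ := by
    rintro ⟨t, ht, heq⟩
    have := nsmul_injOn_Iio_addOrderOf hl (Set.mem_Iio.2 (by omega)) (add_left_cancel heq)
    omega
  have hout : ∀ r ∈ AddSubgroup.zmultiples x, ∀ t : ℕ, a + w - r ≠ a + t • x := by
    intro r hr t heq
    refine hw ?_
    rw [add_sub_assoc, add_right_inj, sub_eq_iff_eq_add] at heq
    exact heq ▸ add_mem (nsmul_mem (AddSubgroup.mem_zmultiples x) t) hr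
  refine zeroForcingNumber_eq_of_forall_eq_univ (v := a + w) hlast (fun r hr => ⟨?_, hout r hr _⟩)
    fun C hC hrow => eq_univ_of_isRowStalled_compl_progression hC hlast hrow
  rintro ⟨t, -, heq⟩
  exact hout r hr t heq

theorem mem_classSet_sdiff_singleton_iff (hl : l < addOrderOf (α : G ⧸ H)) :
    g ∈ classSet H b α l \ {b} ↔
      g - b ∉ H ⊔ .zmultiples α ∨ ∃ t, 1 ≤ t ∧ t ≤ l ∧ (g : G ⧸ H) = b + t • (α : G ⧸ H) := by
  simp only [classSet, Set.mem_sdiff, Set.mem_singleton_iff, Set.mem_ofPred_eq,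
    coe_eq_add_nsmul_iff]
  constructor
  · tauto
  · rintro (h | ⟨t, h1, htl, ht⟩)
    · refine ⟨.inl h, ?_⟩
      rintro rfl
      exact h (by simp)
    · refine ⟨.inr (.inr ⟨t, h1, htl, ht⟩), ?_⟩
      rintro rfl
      exact nsmul_ne_zero_of_lt_addOrderOf (by omega) (htl.trans_lt hl)
        (left_eq_add.1 ((coe_eq_add_nsmul_iff t).2 ht))

/-- The row `g - b` with `g ≡ b - j • α` forces `g`, since its other neighbours outside `C` lie in
the classes of `b - i • α` with `i < j`. -/
theorem mem_of_isRowStalled_classSet (hl : l < addOrderOf (α : G ⧸ H))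
    (hC : classSet H b α l \ {b} ⊆ C)
    (hrow : IsRowStalled (classSet H b α l) {r | ∃ i < N, (r : G ⧸ H) = -(i • (α : G ⧸ H))} C)
    (hj : j < N) (hg : (g : G ⧸ H) = b - j • (α : G ⧸ H)) : g ∈ C := by
  induction j using Nat.strong_induction_on generalizing g with
  | _ j ih =>
    have hgb : ((g - b : G) : G ⧸ H) = -(j • (α : G ⧸ H)) := by
      rw [QuotientAddGroup.mk_sub, hg, sub_sub_cancel_left]
    refine sub_add_cancel g b ▸ hrow.add_mem ⟨j, hj, hgb⟩ (.inr (.inl rfl)) fun s hs hsb => ?_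
    obtain hsK | ⟨t, h1t, htl, hst⟩ := (mem_classSet_sdiff_singleton_iff hl).1 ⟨hs, hsb⟩
    · refine hC ((mem_classSet_sdiff_singleton_iff hl).2 (.inl ?_))
      rwa [add_sub_assoc, AddSubgroup.add_mem_cancel_left]
      rw [← coe_mem_zmultiples_iff_mem_sup, hgb]
      exact neg_mem (nsmul_mem (AddSubgroup.mem_zmultiples _) j)
    obtain hlt | hge := lt_or_ge j t
    · refine hC ((mem_classSet_sdiff_singleton_iff hl).2 (.inr ⟨t - j, by omega, by omega, ?_⟩))
      rw [QuotientAddGroup.mk_add, hgb, hst, sub_nsmul _ hlt.le]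
      abel
    · refine ih (j - t) (by omega) (by omega) ?_
      rw [QuotientAddGroup.mk_add, hgb, hst, sub_nsmul _ hge]
      abel

theorem exists_coe_eq_sub_nsmul [Finite G] (hg : g - b ∈ H ⊔ .zmultiples α) :
    ∃ j < addOrderOf (α : G ⧸ H), (g : G ⧸ H) = b - j • (α : G ⧸ H) := by
  classical
  rw [← neg_mem_iff, ← coe_mem_zmultiples_iff_mem_sup, mem_zmultiples_iff_mem_range_addOrderOf,
    Finset.mem_image] at hg
  obtain ⟨j, hj, hgj⟩ := hg
  exact ⟨j, Finset.mem_range.1 hj, by simp [hgj]⟩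

theorem zeroForcingNumber_classSet_of_ne_top [Finite G] (hl : l < addOrderOf (α : G ⧸ H))
    (hK : H ⊔ .zmultiples α ≠ ⊤) : zeroForcingNumber (bipGraph (circMat (classSet H b α l))) =
      2 * ((classSet H b α l).ncard - 1) := by
  obtain ⟨w, hw⟩ : ∃ w, w ∉ H ⊔ .zmultiples α := by
    simpa [AddSubgroup.eq_top_iff'] using hK
  have hmem : ∀ g, g - b ∉ H ⊔ .zmultiples α → g ∈ classSet H b α l \ {b} := fun g hg =>
    (mem_classSet_sdiff_singleton_iff hl).2 (.inl hg)
  refine zeroForcingNumber_eq_of_forall_eq_univ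
    (L := (H ⊔ AddSubgroup.zmultiples α : AddSubgroup G)) (v := b + w)
    (.inr (.inl rfl)) (fun r hr => hmem _ fun h => hw ?_) fun C hC hrow =>
    Set.eq_univ_of_forall fun g => ?_
  · simpa [add_sub_right_comm] using add_mem h hr
  · by_cases hg : g - b ∈ H ⊔ .zmultiples α
    · obtain ⟨j, hj, hgj⟩ := exists_coe_eq_sub_nsmul hg
      refine mem_of_isRowStalled_classSet hl hC (fun r hr => hrow r ?_) hj hgj
      obtain ⟨i, -, hri⟩ := hr
      rw [SetLike.mem_coe, ← coe_mem_zmultiples_iff_mem_sup, hri]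
      exact neg_mem (nsmul_mem (AddSubgroup.mem_zmultiples _) i)
    · exact hC (hmem g hg)

theorem zeroForcingNumber_classSet_of_eq_top [Finite G] (hl : l < addOrderOf (α : G ⧸ H))
    (hord : addOrderOf (α : G ⧸ H) ≤ 2 * l) (hK : H ⊔ .zmultiples α = ⊤) :
    zeroForcingNumber (bipGraph (circMat (classSet H b α l))) =
      2 * ((classSet H b α l).ncard - 1) := by
  refine zeroForcingNumber_eq_of_forall_eq_univ
    (L := {r | ∃ i < l, (r : G ⧸ H) = -(i • (α : G ⧸ H))}) (v := b + α) (.inr (.inl rfl)) ?_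
    fun C hC hrow => Set.eq_univ_of_forall fun g => ?_
  · rintro r ⟨i, hi, hri⟩
    refine (mem_classSet_sdiff_singleton_iff hl).2 (.inr ⟨i + 1, by omega, by omega, ?_⟩)
    rw [QuotientAddGroup.mk_sub, hri, QuotientAddGroup.mk_add, succ_nsmul]
    abel
  · obtain ⟨j, hj, hgj⟩ := exists_coe_eq_sub_nsmul (g := g) (b := b) (hK ▸ AddSubgroup.mem_top _)
    obtain hjl | hjl := lt_or_ge j l
    · exact mem_of_isRowStalled_classSet hl hC hrow hjl hgj
    · refine hC ((mem_classSet_sdiff_singleton_iff hl).2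
        (.inr ⟨addOrderOf (α : G ⧸ H) - j, by omega, by omega, ?_⟩))
      rw [hgj, sub_nsmul _ hj.le, addOrderOf_nsmul_eq_zero, zero_add, sub_eq_add_neg]

end Attaining

/-! ### Regularity and connectedness -/

section Graph

open scoped Pointwise

variable {G : Type*} [AddCommGroup G] {S : Set G}

theorem ncard_neighborSet_circMat (x : G ⊕ G) :
    ((bipGraph (circMat S)).neighborSet x).ncard = S.ncard := by
  rcases x with i | j
  · have himage : (bipGraph (circMat S)).neighborSet (.inl i) = (fun s => .inr (i + s)) '' S := by
      ext (k | k)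
      · exact iff_of_false id (by simp)
      · rw [SimpleGraph.mem_neighborSet, bipGraph_circMat_adj_inl_inr]
        simp [← eq_sub_iff_add_eq']
    exact himage ▸ Set.ncard_image_of_injective S (Sum.inr_injective.comp (add_right_injective i))
  · have himage : (bipGraph (circMat S)).neighborSet (.inr j) = (fun s => .inl (j - s)) '' S := by
      ext (k | k)
      · rw [SimpleGraph.mem_neighborSet, SimpleGraph.adj_comm, bipGraph_circMat_adj_inl_inr]
        refine ⟨fun hkj => ⟨j - k, hkj, by simp⟩, ?_⟩
        rintro ⟨s, hs, hk⟩
        rwa [← Sum.inl_injective hk, sub_sub_cancel]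
      · exact iff_of_false id (by simp)
    exact himage ▸ Set.ncard_image_of_injective S (Sum.inl_injective.comp sub_right_injective)

theorem isRegularOfDegree_circMat [(bipGraph (circMat S)).LocallyFinite] :
    (bipGraph (circMat S)).IsRegularOfDegree S.ncard := fun x => by
  rw [← ncard_neighborSet_circMat x, ← Nat.card_coe_set_eq, Nat.card_eq_fintype_card,
    SimpleGraph.card_neighborSet_eq_degree]

theorem eq_ncard_of_isRegularOfDegree {V : Type*} {K : SimpleGraph V} [K.LocallyFinite] {k : ℕ}
    (hk : K.IsRegularOfDegree k) (φ : K ≃g bipGraph (circMat S)) : k = S.ncard := by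
  rw [← hk (φ.symm (.inl 0)), ← SimpleGraph.card_neighborSet_eq_degree,
    ← Nat.card_eq_fintype_card, Nat.card_congr (φ.mapNeighborSet _), Nat.card_coe_set_eq,
    ncard_neighborSet_circMat]

theorem reachable_of_mem {i j : G} (h : j - i ∈ S) :
    (bipGraph (circMat S)).Reachable (.inl i) (.inr j) :=
  (bipGraph_circMat_adj_inl_inr.2 h).reachable

theorem reachable_add_of_mem_closure {g : G} (hg : g ∈ AddSubgroup.closure (S - S)) (i : G) :
    (bipGraph (circMat S)).Reachable (.inl i) (.inl (i + g)) := by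
  induction hg using AddSubgroup.closure_induction generalizing i with
  | mem _ hst =>
    obtain ⟨s, hs, t, ht, rfl⟩ := hst
    have hcol : (bipGraph (circMat S)).Reachable (.inl i) (.inr (i + s)) :=
      reachable_of_mem (by rwa [add_sub_cancel_left])
    refine hcol.trans (SimpleGraph.Reachable.symm (reachable_of_mem ?_))
    rwa [add_sub_add_left_eq_sub, sub_sub_cancel]
  | zero => rw [add_zero]
  | add x y _ _ hx hy => exact (hx i).trans (add_assoc i x y ▸ hy (i + x))
  | neg x _ hx => simpa using (hx (i + -x)).symm

theorem connected_circMat (hS : S.Nonempty) (h : AddSubgroup.closure (S - S) = ⊤) :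
    (bipGraph (circMat S)).Connected := by
  obtain ⟨s, hs⟩ := hS
  have hrow : ∀ i, (bipGraph (circMat S)).Reachable (.inl 0) (.inl i) := fun i =>
    zero_add i ▸ reachable_add_of_mem_closure (h ▸ AddSubgroup.mem_top i) 0
  refine SimpleGraph.connected_iff_exists_forall_reachable _ |>.2 ⟨.inl 0, ?_⟩
  rintro (i | j)
  · exact hrow i
  · exact (hrow (j - s)).trans (reachable_of_mem (by rwa [sub_sub_cancel]))

theorem connected_circMat_of_forall_sub_notMem {K : AddSubgroup G} (hK : K ≠ ⊤) {b : G}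
    (hb : b ∈ S) (hS : ∀ g, g - b ∉ K → g ∈ S) : (bipGraph (circMat S)).Connected := by
  refine connected_circMat ⟨b, hb⟩ ((AddSubgroup.eq_top_iff' _).2 fun g => ?_)
  have hout : ∀ x, x ∉ K → x ∈ AddSubgroup.closure (S - S) := fun x hx =>
    AddSubgroup.subset_closure
      ⟨x + b, hS _ (by rwa [add_sub_cancel_right]), b, hb, add_sub_cancel_right x b⟩
  obtain ⟨w, hw⟩ : ∃ w, w ∉ K := by
    by_contra! h
    exact hK ((AddSubgroup.eq_top_iff' _).2 h)
  by_cases hg : g ∈ K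
  · exact (AddSubgroup.add_mem_cancel_right _ (hout w hw)).1
      (hout _ fun h => hw ((AddSubgroup.add_mem_cancel_left _ hg).1 h))
  · exact hout g hg

variable {a b x α : G} {l : ℕ} {H : AddSubgroup G}

theorem connected_circMat_progression (hx : AddSubgroup.zmultiples x = ⊤) (hl : 1 ≤ l) :
    (bipGraph (circMat (progression b x l))).Connected := by
  refine connected_circMat ⟨b, 0, Nat.zero_le _, by simp⟩ (eq_top_iff.2 ?_)
  rw [← hx, AddSubgroup.zmultiples_le]
  exact AddSubgroup.subset_closure
    ⟨b + x, ⟨1, hl, by simp⟩, b, ⟨0, Nat.zero_le _, by simp⟩, by simp⟩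

theorem connected_circMat_compl_progression (hx : AddSubgroup.zmultiples x ≠ ⊤)
    (hl : l + 1 < addOrderOf x) : (bipGraph (circMat (progression a x l)ᶜ)).Connected := by
  refine connected_circMat_of_forall_sub_notMem hx (b := a + (l + 1) • x) ?_ ?_
  · rintro ⟨t, ht, h⟩
    have := nsmul_injOn_Iio_addOrderOf (Set.mem_Iio.2 hl) (Set.mem_Iio.2 (by omega))
      (add_left_cancel h)
    omega
  · rintro g hg ⟨t, -, rfl⟩
    rw [add_sub_add_left_eq_sub] at hg
    exact hg (sub_mem (AddSubgroup.nsmul_mem_zmultiples x t)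
      (AddSubgroup.nsmul_mem_zmultiples x (l + 1)))

theorem connected_circMat_classSet (hl : 1 ≤ l) :
    (bipGraph (circMat (classSet H b α l))).Connected := by
  have hb : b ∈ classSet H b α l := .inr (.inl rfl)
  by_cases hK : H ⊔ .zmultiples α = ⊤
  · refine connected_circMat ⟨b, hb⟩ (eq_top_iff.2 ?_)
    have hmem : ∀ h ∈ H, α + h ∈ AddSubgroup.closure (classSet H b α l - classSet H b α l) :=
      fun h hh => AddSubgroup.subset_closure
        ⟨b + (α + h), .inr (.inr ⟨1, le_rfl, hl, by simpa using hh⟩), b, hb, by simp⟩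
    have hα := add_zero α ▸ hmem 0 (zero_mem H)
    rw [← hK, sup_le_iff, AddSubgroup.zmultiples_le]
    exact ⟨fun h hh => (AddSubgroup.add_mem_cancel_left _ hα).1 (hmem h hh), hα⟩
  · exact connected_circMat_of_forall_sub_notMem hK hb fun g hg => .inl hg

end Graph

/-! ### Permutation equivalence -/

section PermEquiv

variable {l m : Type*} {A B C : Matrix l m ℤ}

theorem PermEquiv.refl (A : Matrix l m ℤ) : PermEquiv A A :=
  ⟨1, 1, rfl⟩

theorem PermEquiv.trans (hAB : PermEquiv A B) (hBC : PermEquiv B C) : PermEquiv A C := by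
  obtain ⟨σ, τ, rfl⟩ := hAB
  obtain ⟨σ', τ', rfl⟩ := hBC
  exact ⟨σ.trans σ', τ.trans τ', rfl⟩

theorem permEquiv_circMat_of_addEquiv {G : Type*} [AddCommGroup G] {S T : Set G} (e : G ≃+ G)
    (c : G) (h : ∀ g, g ∈ S ↔ e g + c ∈ T) : PermEquiv (circMat S) (circMat T) := by
  refine ⟨e, e.toEquiv.trans (Equiv.addRight c), ?_⟩
  ext i j
  have hmem := h (j - i)
  rw [map_sub, sub_add_eq_add_sub] at hmem
  classical exact if_congr hmem rfl rfl

theorem permEquiv_circMat_classSet {G : Type*} [AddCommGroup G] (H : AddSubgroup G) (b b' α : G)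
    (l : ℕ) : PermEquiv (circMat (classSet H b α l)) (circMat (classSet H b' α l)) := by
  refine permEquiv_circMat_of_addEquiv (.refl G) (b' - b) fun g => ?_
  have hsub : g + (b' - b) - b' = g - b := by abel
  have heq : g + (b' - b) = b' ↔ g = b := by rw [← sub_eq_zero, hsub, sub_eq_zero]
  simp only [classSet, Set.mem_ofPred_eq, AddEquiv.refl_apply, hsub, heq]

theorem permEquiv_transpose_circMat {G : Type*} [AddCommGroup G] (S : Set G) :
    PermEquiv (circMat S).transpose (circMat S) := by
  refine ⟨Equiv.neg G, Equiv.neg G, ?_⟩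
  ext i j
  simp [circMat, neg_add_eq_sub]

theorem IsZeroOne.ext (hA : IsZeroOne A) (hB : IsZeroOne B) (h : ∀ i j, A i j = 1 ↔ B i j = 1) :
    A = B := by
  ext i j
  have := h i j
  rcases hA i j with hAij | hAij <;> rcases hB i j with hBij | hBij <;> simp_all

theorem isLeft_ne_of_adj {x y : l ⊕ m} (h : (bipGraph A).Adj x y) : x.isLeft ≠ y.isLeft := by
  rcases x with x | x <;> rcases y with y | y
  exacts [h.elim, Bool.false_ne_true.symm, Bool.false_ne_true, h.elim]

variable {l' m' : Type*} {A' : Matrix l' m' ℤ}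

theorem forall_isLeft_apply_eq_or_forall_ne (hA : (bipGraph A).Connected)
    (φ : bipGraph A ≃g bipGraph A') :
    (∀ x, (φ x).isLeft = x.isLeft) ∨ ∀ x, (φ x).isLeft ≠ x.isLeft := by
  have hadj : ∀ x y, (bipGraph A).Adj x y →
      ((φ x).isLeft = x.isLeft ↔ (φ y).isLeft = y.isLeft) := fun x y hxy => by
    have hleft := isLeft_ne_of_adj hxy
    have hleft' := isLeft_ne_of_adj (φ.map_adj_iff.2 hxy)
    grind
  have hiff : ∀ x y, ((φ x).isLeft = x.isLeft ↔ (φ y).isLeft = y.isLeft) := fun x y => by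
    obtain ⟨p⟩ := hA.preconnected x y
    induction p with
    | nil => exact Iff.rfl
    | cons hxy _ ih => exact (hadj _ _ hxy).trans ih
  by_contra! h
  obtain ⟨⟨x, hx⟩, y, hy⟩ := h
  exact hx ((hiff x y).2 hy)

theorem permEquiv_of_forall_isLeft_apply_eq [Finite l] [Finite m] (hA : IsZeroOne A)
    (hB : IsZeroOne B) (φ : bipGraph A ≃g bipGraph B) (hφ : ∀ x, (φ x).isLeft = x.isLeft) :
    PermEquiv A B := by
  have hmaps : Set.MapsTo φ.toEquiv (Set.range Sum.inl) (Set.range Sum.inl) := by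
    rintro _ ⟨i, rfl⟩
    obtain ⟨i', hi'⟩ := Sum.isLeft_iff.1 (hφ (.inl i))
    exact ⟨i', hi'.symm⟩
  obtain ⟨⟨σ, τ⟩, hστ⟩ := Equiv.Perm.mem_sumCongrHom_range_of_perm_mapsTo_inl hmaps
  refine ⟨σ, τ, hA.ext (fun i j => hB _ _) fun i j => ?_⟩
  have hinl : φ (.inl i) = .inl (σ i) := (DFunLike.congr_fun hστ (Sum.inl i)).symm
  have hinr : φ (.inr j) = .inr (τ j) := (DFunLike.congr_fun hστ (Sum.inr j)).symm
  have hadj := φ.map_adj_iff (v := .inl i) (w := .inr j)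
  rw [hinl, hinr] at hadj
  exact hadj.symm

/-- Transposing a matrix exchanges the two sides of its bipartite graph. -/
def bipGraphTransposeIso (A : Matrix l m ℤ) : bipGraph A ≃g bipGraph A.transpose where
  toEquiv := Equiv.sumComm l m
  map_rel_iff' := by
    rintro (_ | _) (_ | _) <;> rfl

theorem permEquiv_of_iso {A B : Matrix l l ℤ} [Finite l] (hA : IsZeroOne A) (hB : IsZeroOne B)
    (hconn : (bipGraph A).Connected) (φ : bipGraph A ≃g bipGraph B) :
    PermEquiv A B ∨ PermEquiv A B.transpose := by
  rcases forall_isLeft_apply_eq_or_forall_ne hconn φ with h | h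
  · exact .inl (permEquiv_of_forall_isLeft_apply_eq hA hB φ h)
  · refine .inr (permEquiv_of_forall_isLeft_apply_eq hA (fun i j => hB j i)
      (φ.trans (bipGraphTransposeIso B)) fun x => ?_)
    have hswap : ((bipGraphTransposeIso B) (φ x)).isLeft = !(φ x).isLeft := by
      cases φ x <;> rfl
    exact hswap.trans ((Bool.not_eq_eq_eq_not).2 (Bool.eq_not_of_ne (h x)))

end PermEquiv

/-! ### Sums of circulant matrices -/

section Sums

variable {G : Type*} [AddCommGroup G] {S T : Set G}

theorem circMat_union (h : Disjoint S T) : circMat (S ∪ T) = circMat S + circMat T := by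
  ext i j
  exact congrFun (Set.indicator_union_of_disjoint h 1) (j - i)

theorem sum_circMat_preimage_singleton {ι Q : Type*} {s : Finset ι} (f : G → Q) {y : ι → Q}
    (hy : Set.InjOn y s) : ∑ i ∈ s, circMat (f ⁻¹' {y i}) = circMat (f ⁻¹' (y '' s)) := by
  have hdisj : (s : Set ι).PairwiseDisjoint fun i => f ⁻¹' {y i} := fun i hi j hj hij =>
    (Set.disjoint_singleton.2 (hy.ne hi hj hij)).preimage f
  have hunion : f ⁻¹' (y '' s) = ⋃ i ∈ s, f ⁻¹' {y i} := by
    ext g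
    simp [eq_comm]
  ext i j
  rw [Matrix.sum_apply, hunion]
  exact (Finset.indicator_biUnion_apply s _ hdisj (j - i)).symm

theorem image_add_nsmul_Iio_addOrderOf [Finite G] (b x : G) :
    (fun t : ℕ => b + t • x) '' Set.Iio (addOrderOf x) =
      {g | g - b ∈ AddSubgroup.zmultiples x} := by
  classical
  ext g
  simp [mem_zmultiples_iff_mem_range_addOrderOf, eq_sub_iff_add_eq']

theorem sum_circMat_preimage_add_nsmul {Q : Type*} [AddCommGroup Q] [Finite Q] (f : G → Q)
    (b x : Q) : ∑ t ∈ Finset.range (addOrderOf x), circMat (f ⁻¹' {b + t • x}) =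
      circMat {g | f g - b ∈ AddSubgroup.zmultiples x} := by
  rw [sum_circMat_preimage_singleton f, Finset.coe_range, image_add_nsmul_Iio_addOrderOf]
  · rfl
  · rw [Finset.coe_range]
    exact injOn_add_nsmul b x

theorem sum_circMat_singleton_add_nsmul {b x : G} {l : ℕ} (hl : l < addOrderOf x) :
    ∑ t ∈ Finset.range (l + 1), circMat {b + t • x} = circMat (progression b x l) := by
  have hrange : (Finset.range (l + 1) : Set ℕ) = Set.Iic l := by
    ext
    simp
  have hinj : Set.InjOn (fun t : ℕ => b + t • x) (Finset.range (l + 1)) :=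
    (injOn_add_nsmul b x).mono (hrange ▸ Set.Iic_subset_Iio.2 hl)
  rw [progression_eq_image, ← hrange]
  exact sum_circMat_preimage_singleton id hinj

theorem circMat_classSet {H : AddSubgroup G} {b α : G} {l : ℕ} (hl : l < addOrderOf (α : G ⧸ H)) :
    circMat (classSet H b α l) = circMat {g | g - b ∉ H ⊔ .zmultiples α} + circMat {b} +
      ∑ t ∈ Finset.Icc 1 l, circMat {g | g - (b + t • α) ∈ H} := by
  let f : G → G ⧸ H := (↑)
  let y : ℕ → G ⧸ H := fun t => b + t • α
  have hmem : ∀ (t : ℕ) (g : G), g - (b + t • α) ∈ H ↔ f g = y t := fun t g =>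
    QuotientAddGroup.eq_iff_sub_mem.symm
  have hy : Set.InjOn y (Set.Iic l) := (injOn_add_nsmul _ _).mono (Set.Iic_subset_Iio.2 hl)
  have hset : classSet H b α l =
      {g | g - b ∉ H ⊔ .zmultiples α} ∪ {b} ∪ f ⁻¹' (y '' Finset.Icc 1 l) := by
    ext g
    simp [classSet, or_assoc, or_left_comm, and_assoc, sub_sub, hmem, eq_comm]
  rw [hset, circMat_union, circMat_union, ← sum_circMat_preimage_singleton f]
  · simp only [hmem]
    rfl
  · exact hy.mono fun t ht => (Finset.mem_Icc.1 ht).2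
  · simp
  · rw [Set.disjoint_left]
    rintro g (hg | rfl) ⟨t, ht, htg⟩
    · refine hg (coe_mem_zmultiples_iff_mem_sup.1 ⟨t, ?_⟩)
      simp [← show y t = (g : G ⧸ H) from htg, y]
    · have := hy (Set.mem_Iic.2 (Finset.mem_Icc.1 ht).2) (Set.mem_Iic.2 (Nat.zero_le l))
        (htg.trans (by simp [f, y]))
      exact Nat.one_ne_zero (Nat.le_zero.1 (this ▸ (Finset.mem_Icc.1 ht).1))

end Sums

/-! ### Subgroups of `ℤ/nℤ` -/

section ZMod

variable {n d : ℕ}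

theorem castHom_eq_zero_iff_mem_zmultiples (hd : d ∣ n) (g : ZMod n) :
    ZMod.castHom hd (ZMod d) g = 0 ↔ g ∈ AddSubgroup.zmultiples (d : ZMod n) := by
  constructor
  · intro hg
    obtain ⟨m, rfl⟩ := ZMod.intCast_surjective g
    rw [map_intCast, ZMod.intCast_zmod_eq_zero_iff_dvd] at hg
    obtain ⟨z, rfl⟩ := hg
    exact ⟨z, by simp [mul_comm]⟩
  · rintro ⟨z, rfl⟩
    exact (map_zsmul _ z _).trans (by simp)

theorem zmultiples_natCast_sup (a b : ℕ) :
    AddSubgroup.zmultiples (a : ZMod n) ⊔ AddSubgroup.zmultiples (b : ZMod n) =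
      AddSubgroup.zmultiples ((Nat.gcd a b : ℕ) : ZMod n) := by
  simpa [AddSubgroup.map_sup, AddMonoidHom.map_zmultiples] using
    congrArg (AddSubgroup.map (Int.castAddHom (ZMod n))) (Int.zmultiples_sup a b)

theorem zmultiples_natCast_eq_top_iff [NeZero n] (a : ℕ) :
    AddSubgroup.zmultiples (a : ZMod n) = ⊤ ↔ Nat.gcd a n = 1 := by
  rw [← AddSubgroup.card_eq_iff_eq_top, Nat.card_zmultiples, Nat.card_zmod,
    ZMod.addOrderOf_coe a (NeZero.ne n), Nat.gcd_comm,
    Nat.div_eq_self, or_iff_right (NeZero.ne n)]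

theorem exists_dvd_eq_zmultiples (H : AddSubgroup (ZMod n)) :
    ∃ d : ℕ, d ∣ n ∧ H = AddSubgroup.zmultiples (d : ZMod n) := by
  obtain ⟨z, rfl⟩ := H.isAddCyclic_iff_exists_zmultiples_eq_top.1 inferInstance
  obtain ⟨m, rfl⟩ := ZMod.intCast_surjective z
  refine ⟨Int.gcd n m, Int.natCast_dvd_natCast.1 (Int.gcd_dvd_left ..), ?_⟩
  simpa [AddSubgroup.map_sup, AddMonoidHom.map_zmultiples] using
    congrArg (AddSubgroup.map (Int.castAddHom (ZMod n))) (Int.zmultiples_sup n m)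

theorem addOrderOf_natCast_quotient_zmultiples [NeZero n] (hd : d ∣ n) (a : ℕ) :
    addOrderOf ((a : ZMod n) : ZMod n ⧸ AddSubgroup.zmultiples (d : ZMod n)) =
      d / Nat.gcd d a := by
  rw [← ZMod.addOrderOf_coe a (ne_zero_of_dvd_ne_zero (NeZero.ne n) hd),
    addOrderOf_eq_addOrderOf_iff]
  intro t
  rw [← QuotientAddGroup.mk_nsmul, QuotientAddGroup.eq_zero_iff,
    ← castHom_eq_zero_iff_mem_zmultiples hd, map_nsmul, map_natCast]

theorem range_natCast_eq_compl_singleton {c β : ℕ} [NeZero c] {γ : Fin (c - 1) → ℕ}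
    (hγ : ∀ j j', γ j ≡ γ j' [MOD c] → j = j') (hγβ : ∀ j, ¬ γ j ≡ β [MOD c]) :
    Set.range (fun j => (γ j : ZMod c)) = {(β : ZMod c)}ᶜ := by
  refine Set.eq_of_subset_of_ncard_le ?_ ?_ (Set.toFinite _)
  · rintro _ ⟨j, rfl⟩
    exact fun h => hγβ j ((ZMod.natCast_eq_natCast_iff _ _ _).1 h)
  · have hinj : Function.Injective fun j => (γ j : ZMod c) := fun j j' h =>
      hγ j j' ((ZMod.natCast_eq_natCast_iff _ _ _).1 h)
    rw [Set.ncard_range_of_injective hinj, Set.ncard_compl]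
    simp

end ZMod

/-! ### The three families -/

section Families

variable {n : ℕ} {S : Set (ZMod n)}

theorem isCirculant_circMat (S : Set (ZMod n)) : IsCirculant (circMat S) :=
  ⟨fun x => S.indicator 1 (-x), by ext; simp [circMat]⟩

theorem IsCirculant.exists_eq_circMat {A : Matrix (ZMod n) (ZMod n) ℤ} (hA : IsCirculant A)
    (hA01 : IsZeroOne A) : ∃ S : Set (ZMod n), A = circMat S := by
  obtain ⟨v, rfl⟩ := hA
  refine ⟨{x | v (-x) = 1}, hA01.ext (isZeroOne_circMat _) fun i j => ?_⟩
  simp [circMat_apply_eq_one]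

theorem J_sub_circMat (S : Set (ZMod n)) : J n - circMat S = circMat Sᶜ := by
  ext i j
  by_cases hS : j - i ∈ S <;> simp [circMat, J, hS]

variable [NeZero n]

theorem P_pow_eq_circMat (x : ℕ) : P n ^ x = circMat {(x : ZMod n)} := by
  induction x with
  | zero =>
    ext i j
    simp [circMat, Matrix.one_apply, Set.indicator_apply, sub_eq_zero, eq_comm]
  | succ x ih =>
    ext i j
    have hP : ∀ m, P n m j = if m = j - 1 then 1 else 0 := fun m => by
      simp [P, eq_sub_iff_add_eq, eq_comm]
    simp [pow_succ, ih, Matrix.mul_apply, hP, circMat, Set.indicator_apply, sub_eq_iff_eq_add,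
      add_right_comm]

theorem sum_P_pow_eq_circMat {a x l : ℕ} (hl : l < addOrderOf (x : ZMod n)) :
    ∑ t ∈ Finset.range (l + 1), P n ^ (a + t * x) = circMat (progression (a : ZMod n) x l) := by
  rw [← sum_circMat_singleton_add_nsmul hl]
  simp [P_pow_eq_circMat]

theorem PClass_eq_circMat (a d : ℕ) :
    PClass n a d = circMat {g | g - (a : ZMod n) ∈ AddSubgroup.zmultiples (d : ZMod n)} := by
  refine .trans ?_ (sum_circMat_preimage_add_nsmul id (a : ZMod n) d)
  simp [PClass, P_pow_eq_circMat]

theorem PClass_eq_circMat_preimage {d : ℕ} (hd : d ∣ n) (a : ℕ) :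
    PClass n a d = circMat (ZMod.castHom hd (ZMod d) ⁻¹' {(a : ZMod d)}) := by
  rw [PClass_eq_circMat]
  congr 1
  ext g
  rw [Set.mem_ofPred_eq, ← castHom_eq_zero_iff_mem_zmultiples hd, map_sub, map_natCast,
    sub_eq_zero, Set.mem_preimage, Set.mem_singleton_iff]

theorem PClassClass_eq_circMat_preimage {c d : ℕ} (hcd : c ∣ d) (hd : d ∣ n) (a : ℕ) :
    PClassClass n a c d =
      circMat (ZMod.castHom (hcd.trans hd) (ZMod c) ⁻¹' {(a : ZMod c)}) := by
  have : NeZero d := ⟨ne_zero_of_dvd_ne_zero (NeZero.ne n) hd⟩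
  have hsum := sum_circMat_preimage_add_nsmul (ZMod.castHom hd (ZMod d)) (a : ZMod d) (c : ZMod d)
  rw [PClassClass, Nat.gcd_eq_right hd]
  simp only [PClass_eq_circMat_preimage hd, Nat.cast_add, Nat.cast_mul, ← nsmul_eq_mul]
  rw [hsum]
  congr 1
  ext g
  rw [Set.mem_ofPred_eq, ← castHom_eq_zero_iff_mem_zmultiples hcd, map_sub, map_natCast,
    sub_eq_zero, ← RingHom.comp_apply, ZMod.castHom_comp, Set.mem_preimage, Set.mem_singleton_iff]

theorem sum_PClassClass_eq_circMat {d c β : ℕ} {γ : Fin (c - 1) → ℕ} (hd : d ∣ n) (hcd : c ∣ d)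
    (hγ : ∀ j j', γ j ≡ γ j' [MOD c] → j = j') (hγβ : ∀ j, ¬ γ j ≡ β [MOD c]) :
    ∑ j, PClassClass n (γ j) c d =
      circMat {g | g - (β : ZMod n) ∉ AddSubgroup.zmultiples (c : ZMod n)} := by
  have : NeZero c := ⟨ne_zero_of_dvd_ne_zero (NeZero.ne n) (hcd.trans hd)⟩
  have hinj : Set.InjOn (fun j => (γ j : ZMod c)) (Finset.univ : Finset (Fin (c - 1))) :=
    fun j _ j' _ h => hγ j j' ((ZMod.natCast_eq_natCast_iff _ _ _).1 h)
  simp only [PClassClass_eq_circMat_preimage hcd hd]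
  rw [sum_circMat_preimage_singleton _ hinj, Finset.coe_univ, Set.image_univ,
    range_natCast_eq_compl_singleton hγ hγβ]
  congr 1
  ext g
  rw [Set.mem_ofPred_eq, ← castHom_eq_zero_iff_mem_zmultiples (hcd.trans hd), map_sub, map_natCast,
    sub_eq_zero, Set.mem_preimage, Set.mem_compl_singleton_iff]

theorem sum_eq_circMat_classSet {d α β l c : ℕ} {γ : Fin (c - 1) → ℕ} (hd : d ∣ n)
    (hc : c = Nat.gcd d α) (hl : l < d / c) (hγ : ∀ j j', γ j ≡ γ j' [MOD c] → j = j')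
    (hγβ : ∀ j, ¬ γ j ≡ β [MOD c]) :
    ∑ j, PClassClass n (γ j) c d + P n ^ β + ∑ t ∈ Finset.Icc 1 l, PClass n (β + t * α) d =
      circMat (classSet (.zmultiples (d : ZMod n)) (β : ZMod n) α l) := by
  rw [circMat_classSet (by rwa [addOrderOf_natCast_quotient_zmultiples hd, ← hc]),
    sum_PClassClass_eq_circMat hd (hc ▸ Nat.gcd_dvd_left d α) hγ hγβ, P_pow_eq_circMat,
    zmultiples_natCast_sup, ← hc]
  simp [PClass_eq_circMat]

theorem IsFamily1.exists_eq_circMat {k : ℕ} {M : Matrix (ZMod n) (ZMod n) ℤ}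
    (hM : IsFamily1 n k M) : ∃ S : Set (ZMod n), M = circMat S ∧ (bipGraph (circMat S)).Connected ∧
      zeroForcingNumber (bipGraph (circMat S)) = 2 * (S.ncard - 1) := by
  obtain ⟨hk2, hkn, rfl⟩ := hM
  obtain ⟨l, rfl⟩ := Nat.exists_eq_add_of_le' (one_le_two.trans hk2)
  have hl : l < addOrderOf ((1 : ℕ) : ZMod n) := by
    rw [Nat.cast_one, ZMod.addOrderOf_one]
    omega
  have htop : AddSubgroup.zmultiples ((1 : ℕ) : ZMod n) = ⊤ := by
    rw [zmultiples_natCast_eq_top_iff, Nat.gcd_one_left]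
  refine ⟨_, ?_, connected_circMat_progression htop (by omega),
    zeroForcingNumber_progression (b := ((0 : ℕ) : ZMod n)) htop (by omega) hl⟩
  rw [← sum_P_pow_eq_circMat hl]
  simp only [zero_add, mul_one]

theorem IsFamily2.exists_eq_circMat {M : Matrix (ZMod n) (ZMod n) ℤ}
    (hM : IsFamily2 n M) : ∃ S : Set (ZMod n), M = circMat S ∧ (bipGraph (circMat S)).Connected ∧
      zeroForcingNumber (bipGraph (circMat S)) = 2 * (S.ncard - 1) := by
  obtain ⟨a, r, i, hi, hr, rfl⟩ := hM
  have htop : AddSubgroup.zmultiples (i : ZMod n) ≠ ⊤ :=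
    (zmultiples_natCast_eq_top_iff i).not.2 hi.ne'
  refine ⟨_, ?_, connected_circMat_compl_progression htop hr,
    zeroForcingNumber_compl_progression (a := (a : ZMod n)) htop hr⟩
  rw [sum_P_pow_eq_circMat (by omega), J_sub_circMat]

theorem IsFamily3.exists_eq_circMat {M : Matrix (ZMod n) (ZMod n) ℤ}
    (hM : IsFamily3 n M) : ∃ S : Set (ZMod n), M = circMat S ∧ (bipGraph (circMat S)).Connected ∧
      zeroForcingNumber (bipGraph (circMat S)) = 2 * (S.ncard - 1) := by
  obtain ⟨d, α, β, l, c, γ, hd, hc, hl, hlc, hγ, hγβ, hcond, rfl⟩ := hM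
  have hord := hc ▸ addOrderOf_natCast_quotient_zmultiples hd α
  refine ⟨_, sum_eq_circMat_classSet hd hc hlc hγ hγβ, connected_circMat_classSet hl, ?_⟩
  have hK : AddSubgroup.zmultiples (d : ZMod n) ⊔ AddSubgroup.zmultiples (α : ZMod n) = ⊤ ↔
      c = 1 := by
    rw [zmultiples_natCast_sup, zmultiples_natCast_eq_top_iff, ← hc,
      Nat.gcd_eq_left ((hc ▸ Nat.gcd_dvd_left d α).trans hd)]
  by_cases hc1 : c = 1
  · subst hc1
    obtain ⟨m, hm, hml, -, hdm⟩ := hcond.resolve_left fun ⟨j, _⟩ => j.elim0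
    exact zeroForcingNumber_classSet_of_eq_top (hord ▸ hlc) (by omega) (hK.2 rfl)
  · exact zeroForcingNumber_classSet_of_ne_top (hord ▸ hlc) (hK.not.2 hc1)

/-! ### Classification -/

theorem exists_isFamily1_of_progression {b x : ZMod n} {l : ℕ}
    (hx : AddSubgroup.zmultiples x = ⊤) (hl : 1 ≤ l) (hlx : l < addOrderOf x) :
    ∃ M, IsFamily1 n (l + 1) M ∧ PermEquiv (circMat (progression b x l)) M := by
  obtain ⟨z, hz⟩ : (1 : ZMod n) ∈ AddSubgroup.zmultiples x := hx ▸ AddSubgroup.mem_top 1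
  let u : (ZMod n)ˣ := .mkOfMulEqOne x z (by simpa [mul_comm] using hz)
  have hln : l < n := hlx.trans_le (addOrderOf_le_card.trans_eq (Nat.card_zmod n))
  have hM : ∑ t ∈ Finset.range (l + 1), P n ^ t = circMat (progression 0 1 l) := by
    simpa using sum_P_pow_eq_circMat (n := n) (a := 0) (x := 1) (by simpa [ZMod.addOrderOf_one])
  refine ⟨_, ⟨by omega, hln, rfl⟩, hM ▸ permEquiv_circMat_of_addEquiv
    (DistribMulAction.toAddEquiv (ZMod n) u⁻¹) (-(u⁻¹ • b)) fun g => ?_⟩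
  have hmem : ∀ t : ℕ, g = b + t • x ↔ u⁻¹ • g + -(u⁻¹ • b) = 0 + t • 1 := fun t => by
    rw [← smul_neg, ← smul_add, inv_smul_eq_iff, ← sub_eq_add_neg, zero_add, smul_comm,
      sub_eq_iff_eq_add']
    simp [u, Units.smul_def]
  simp only [progression, Set.mem_ofPred_eq, hmem, DistribMulAction.toAddEquiv_apply]

theorem isFamily2_circMat_compl_progression {a x : ZMod n} {l : ℕ}
    (hx : AddSubgroup.zmultiples x ≠ ⊤) (hl : l + 1 < addOrderOf x) :
    IsFamily2 n (circMat (progression a x l)ᶜ) := by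
  obtain ⟨x, rfl⟩ := ZMod.natCast_zmod_surjective x
  obtain ⟨a, rfl⟩ := ZMod.natCast_zmod_surjective a
  have hgcd : Nat.gcd x n ≠ 1 := (zmultiples_natCast_eq_top_iff x).not.1 hx
  have hpos : 0 < Nat.gcd x n := Nat.gcd_pos_of_pos_right x (NeZero.pos n)
  refine ⟨a, l, x, by omega, hl, ?_⟩
  rw [sum_P_pow_eq_circMat (by omega), J_sub_circMat]

theorem exists_isFamily3_of_gcd_eq_one {d α l : ℕ} {b : ZMod n} (hd : d ∣ n)
    (hα : Nat.gcd d α = 1) (hld : l + 1 < d) (hdl : d ≤ 2 * l) :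
    ∃ M, IsFamily3 n M ∧
      PermEquiv (circMat (classSet (.zmultiples (d : ZMod n)) b α l)) M := by
  have hγ : ∀ j j' : Fin (1 - 1), Fin.elim0 j ≡ Fin.elim0 j' [MOD 1] → j = j' := fun j => j.elim0
  have hγβ : ∀ j : Fin (1 - 1), ¬ Fin.elim0 j ≡ (-(α : ZMod n)).val [MOD 1] := fun j => j.elim0
  refine ⟨_, ⟨d, α, (-(α : ZMod n)).val, l, 1, Fin.elim0, hd, hα.symm, by omega, by omega, hγ, hγβ,
    .inr ⟨1, le_rfl, by omega, ⟨0, by simp⟩, by omega⟩, rfl⟩, ?_⟩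
  rw [sum_eq_circMat_classSet hd hα.symm (by omega) hγ hγβ]
  exact permEquiv_circMat_classSet ..

theorem exists_isFamily3_of_gcd_ne_one {d α l : ℕ} {b : ZMod n} (hd : d ∣ n)
    (hα : Nat.gcd d α ≠ 1) (hl : 1 ≤ l) (hld : l < d / Nat.gcd d α) :
    ∃ M, IsFamily3 n M ∧
      PermEquiv (circMat (classSet (.zmultiples (d : ZMod n)) b α l)) M := by
  have hc : 0 < Nat.gcd d α := Nat.pos_of_ne_zero fun h => by simp [h] at hld
  have hγ : ∀ j j' : Fin (Nat.gcd d α - 1), (j : ℕ) ≡ j' [MOD Nat.gcd d α] → j = j' :=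
    fun j j' h => Fin.ext (h.eq_of_lt_of_lt (by omega) (by omega))
  have hγβ : ∀ j : Fin (Nat.gcd d α - 1), ¬ (j : ℕ) ≡ Nat.gcd d α - 1 [MOD Nat.gcd d α] :=
    fun j h => j.2.ne (h.eq_of_lt_of_lt (by omega) (by omega))
  have hα_mem : (α : ZMod n) ∈ resClassClass ((0 : ℕ) : ZMod n) (Nat.gcd d α : ℕ) d :=
    ⟨α / Nat.gcd d α, 0, by simp [← Nat.cast_mul, Nat.div_mul_cancel (Nat.gcd_dvd_right d α)]⟩
  refine ⟨_, ⟨d, α, Nat.gcd d α - 1, l, Nat.gcd d α, (↑), hd, rfl, hl, hld, hγ, hγβ,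
    .inl ⟨⟨0, by omega⟩, hα_mem⟩, rfl⟩, ?_⟩
  rw [sum_eq_circMat_classSet hd rfl hld hγ hγβ]
  exact permEquiv_circMat_classSet ..

theorem exists_isFamily3_of_classSet {H : AddSubgroup (ZMod n)} {b α w : ZMod n} {l : ℕ}
    (hH : H ≠ ⊥) (hl : 1 ≤ l) (hlα : l + 1 < addOrderOf (α : ZMod n ⧸ H))
    (hw : w ∈ classSet H b α l)
    (hforce : IsForcingPair (classSet H b α l) ((w - ·) ⁻¹' classSet H b α l)
      (classSet H b α l)) :
    ∃ M, IsFamily3 n M ∧ PermEquiv (circMat (classSet H b α l)) M := by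
  obtain ⟨d, hd, rfl⟩ := exists_dvd_eq_zmultiples H
  obtain ⟨α, rfl⟩ := ZMod.natCast_zmod_surjective α
  have hord := addOrderOf_natCast_quotient_zmultiples hd α
  rw [hord] at hlα
  by_cases hα : Nat.gcd d α = 1
  · have htop : AddSubgroup.zmultiples (d : ZMod n) ⊔ .zmultiples (α : ZMod n) = ⊤ := by
      rw [zmultiples_natCast_sup, hα, zmultiples_natCast_eq_top_iff, Nat.gcd_one_left]
    have hle := addOrderOf_le_of_isForcingPair hH hl htop hw hforce
    rw [hord] at hle
    rw [hα, Nat.div_one] at hlα hle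
    exact exists_isFamily3_of_gcd_eq_one hd hα hlα hle
  · exact exists_isFamily3_of_gcd_ne_one hd hα hl (by omega)

theorem progression_zero_one_eq_univ : progression (0 : ZMod n) 1 (n - 1) = Set.univ :=
  Set.eq_univ_of_forall fun g => ⟨g.val, Nat.le_sub_one_of_lt g.val_lt, by simp⟩

theorem exists_isFamily
    (hZ : zeroForcingNumber (bipGraph (circMat S)) = 2 * (S.ncard - 1)) :
    ∃ M, (IsFamily1 n S.ncard M ∨ IsFamily2 n M ∨ IsFamily3 n M) ∧ PermEquiv (circMat S) M := by
  have hk : 2 ≤ S.ncard := by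
    have := zeroForcingNumber_pos (G := bipGraph (circMat S))
    omega
  have hcard : S.ncard ≤ Nat.card (ZMod n) := Set.ncard_le_card S
  obtain ⟨w, hw, hforce⟩ := exists_isForcingPair_of_zeroForcingNumber_eq (by omega) hZ
  have hprog : ∀ {b x : ZMod n} {l : ℕ}, S = progression b x l → AddSubgroup.zmultiples x = ⊤ →
      l < addOrderOf x →
      ∃ M, (IsFamily1 n S.ncard M ∨ IsFamily2 n M ∨ IsFamily3 n M) ∧ PermEquiv (circMat S) M := by
    rintro b x l rfl hx hlx
    rw [ncard_progression hlx] at hk ⊢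
    obtain ⟨M, hM, hperm⟩ :=
      exists_isFamily1_of_progression (b := b) hx (Nat.le_of_succ_le_succ hk) hlx
    exact ⟨M, .inl hM, hperm⟩
  rcases eq_or_ne S Set.univ with huniv | huniv
  · refine hprog (huniv.trans progression_zero_one_eq_univ.symm) ?_ ?_
    · simpa using (zmultiples_natCast_eq_top_iff (n := n) 1).2 (Nat.gcd_one_left n)
    · rw [ZMod.addOrderOf_one]
      exact Nat.sub_one_lt (NeZero.ne n)
  · have hS : S.Nontrivial := Set.one_lt_ncard_iff_nontrivial.1 hk
    rcases hforce.isExpanding.exists_structure hS huniv with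
      ⟨b, x, l, hx, hl, h⟩ | ⟨a, x, l, hx, hl, h⟩ | ⟨H, b, α, l, hH, hl, hlα, rfl⟩
    · exact hprog h hx (by omega)
    · refine ⟨circMat S, .inr (.inl ?_), .refl _⟩
      rw [← compl_compl S, h]
      exact isFamily2_circMat_compl_progression hx hl
    · obtain ⟨M, hM, hperm⟩ := exists_isFamily3_of_classSet hH hl hlα hw hforce
      exact ⟨M, .inr (.inr hM), hperm⟩

end Families

end BipCirc

theorem mainTheorem1 (n : ℕ) [NeZero n] :
    (∀ (k : ℕ) (V : Type*) [Fintype V] (G : SimpleGraph V) [G.LocallyFinite],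
      IsBipartiteCirculant G n → G.Connected → G.IsRegularOfDegree k →
      zeroForcingNumber G = 2 * (k - 1) →
        ∃ M : Matrix (ZMod n) (ZMod n) ℤ,
          (IsFamily1 n k M ∨ IsFamily2 n M ∨ IsFamily3 n M) ∧
          ∀ A : Matrix (ZMod n) (ZMod n) ℤ, IsBiadjacencyMatrix G A → PermEquiv A M) ∧
    (∀ M : Matrix (ZMod n) (ZMod n) ℤ,
      ((∃ k, IsFamily1 n k M) ∨ IsFamily2 n M ∨ IsFamily3 n M) →
        IsZeroOne M ∧ IsCirculant M ∧ (bipGraph M).Connected ∧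
        ∃ k : ℕ, (bipGraph M).IsRegularOfDegree k ∧
          zeroForcingNumber (bipGraph M) = 2 * (k - 1)) := by
  constructor
  · rintro k V _ G _ ⟨A₀, hcirc, h01, ⟨φ⟩⟩ hconn hreg hZ
    obtain ⟨S, rfl⟩ := hcirc.exists_eq_circMat h01
    obtain rfl := eq_ncard_of_isRegularOfDegree hreg φ
    rw [zeroForcingNumber_congr φ] at hZ
    obtain ⟨M, hM, hp⟩ := exists_isFamily hZ
    refine ⟨M, hM, fun A ⟨hA, ⟨ψ⟩⟩ => ?_⟩
    rcases permEquiv_of_iso hA h01 (ψ.connected_iff.1 hconn) (ψ.symm.trans φ) with h | h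
    · exact h.trans hp
    · exact (h.trans (permEquiv_transpose_circMat S)).trans hp
  · intro M hM
    obtain ⟨S, rfl, hconn, hZ⟩ : ∃ S : Set (ZMod n), M = circMat S ∧
        (bipGraph (circMat S)).Connected ∧
        zeroForcingNumber (bipGraph (circMat S)) = 2 * (S.ncard - 1) := by
      rcases hM with ⟨k, hM⟩ | hM | hM <;> exact hM.exists_eq_circMat
    exact ⟨isZeroOne_circMat S, isCirculant_circMat S, hconn, S.ncard, isRegularOfDegree_circMat,
      hZ⟩
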